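/- Let $\chi,\varphi:\mathbb{R}\to[0,1]$ be smooth functions with $\operatorname{Supp}\chi\subset\{|\xi|\le \tfrac43\}$ and $\operatorname{Supp}\varphi\subset\{\tfrac34\le|\xi|\le\tfrac83\}$ such that $\chi(\xi)+\sum_{j\ge 0}\varphi(2^{-j}\xi)=1$ for all $\xi\in\mathbb{R}$, $\sum_{j\in\mathbb{Z}}\varphi(2^{-j}\xi)=1$ for all $\xi\neq 0$, $\operatorname{Supp}\varphi(2^{-j}\cdot)\cap\operatorname{Supp}\varphi(2^{-k}\cdot)=\emptyset$ if $|j-k|\ge 2$, and $\operatorname{Supp}\chi\cap\operatorname{Supp}\varphi(2^{-j}\cdot)=\emptyset$ if $j\ge 1$. For a (complex-valued) tempered distribution $u\in\mathcal{S}'(\mathbb{R})$, put $\Delta_ju=0$ for $j\le -2$, $\Delta_{-1}u=\mathcal{F}^{-1}(\chi\,\mathcal{F}u)$ and $\Delta_ju=\mathcal{F}^{-1}(\varphi(2^{-j}\cdot)\,\mathcal{F}u)$ for $j\ge 0$, where $\mathcal{F}$ is the Fourier transform $\mathcal{F}f(\xi)=\int_{\mathbb{R}}e^{-2\pi i x\xi}f(x)\,dx$.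 For $\sigma\in\mathbb{R}$ and $1\le p,r\le\infty$ let $\|u\|_{B^{\sigma}_{p,r}}=\big\|(2^{j\sigma}\|\Delta_ju\|_{L^p})_{j}\big\|_{\ell^r(\mathbb{Z})}\in[0,\infty]$, and let $B^{\sigma}_{p,r}=B^{\sigma}_{p,r}(\mathbb{R})$ be the space of all $u\in\mathcal{S}'(\mathbb{R})$ for which this is finite. The product of two tempered distributions is $uv=\sum_{(j',j)\in\mathbb{Z}^2}\Delta_{j'}u\,\Delta_jv$, defined whenever this double series converges unconditionally in $\mathcal{S}'(\mathbb{R})$ (each term is a product of two smooth functions of polynomial growth). **Lemma 3.2.** Let $1\le p,r\le\infty$ and $s\in\mathbb{R}$ satisfy either $s>\max\{2,\tfrac1p+\tfrac32\}$, or $s=2$, $2\le p\le\infty$ and $1\le r\le 2$. Then there is a constant $C$ (depending only on $s,p,r$ and the choice of $\chi,\varphi$) such that for all $u,v\in B^{s-2}_{p,r}$ the product $uv$ exists in $\mathcal{S}'(\mathbb{R})$ and $$\|uv\|_{B^{s-3}_{p,r}}\le C\,\|u\|_{B^{s-2}_{p,r}}\,\|v\|_{B^{s-2}_{p,r}}.$$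 -/

import Mathlib

open MeasureTheory
open scoped ENNReal NNReal ContDiff SchwartzMap

/-- A pair `(χ, φ)` of cut-off functions on the line generating a nonhomogeneous
Littlewood-Paley decomposition: smooth, valued in `[0, 1]`, supported in the ball `|ξ| ≤ 4/3` and
in the annulus `3/4 ≤ |ξ| ≤ 8/3` respectively, and generating dyadic partitions of unity. -/
structure IsLittlewoodPaleyPair (χ φ : ℝ → ℝ) : Prop where
  contDiff_low : ContDiff ℝ ∞ χ
  contDiff_high : ContDiff ℝ ∞ φ
  low_mem : ∀ ξ, χ ξ ∈ Set.Icc (0 : ℝ) 1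
  high_mem : ∀ ξ, φ ξ ∈ Set.Icc (0 : ℝ) 1
  tsupport_low : tsupport χ ⊆ {ξ | |ξ| ≤ 4 / 3}
  tsupport_high : tsupport φ ⊆ {ξ | 3 / 4 ≤ |ξ| ∧ |ξ| ≤ 8 / 3}
  partition_nonhomogeneous : ∀ ξ : ℝ, HasSum (fun j : ℕ => φ ((2 : ℝ) ^ (-(j : ℤ)) * ξ)) (1 - χ ξ)
  partition_homogeneous : ∀ ξ : ℝ, ξ ≠ 0 → HasSum (fun j : ℤ => φ ((2 : ℝ) ^ (-j) * ξ)) 1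
  disjoint_high : ∀ j k : ℤ, 2 ≤ |j - k| →
    Disjoint (tsupport fun ξ : ℝ => φ ((2 : ℝ) ^ (-j) * ξ))
      (tsupport fun ξ : ℝ => φ ((2 : ℝ) ^ (-k) * ξ))
  disjoint_low : ∀ j : ℤ, 1 ≤ j →
    Disjoint (tsupport χ) (tsupport fun ξ : ℝ => φ ((2 : ℝ) ^ (-j) * ξ))

/-- The symbol of the `j`-th nonhomogeneous dyadic block. -/
noncomputable def dyadicSymbol (χ φ : ℝ → ℝ) (j : ℤ) (ξ : ℝ) : ℂ :=
  if j ≤ -2 then 0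
  else if j = -1 then (χ ξ : ℂ)
  else (φ ((2 : ℝ) ^ (-j) * ξ) : ℂ)

/-- The nonhomogeneous dyadic block `Δ_j u = 𝓕⁻¹ (symbol · 𝓕 u)` of a tempered distribution. -/
noncomputable def dyadicBlock (χ φ : ℝ → ℝ) (j : ℤ) (u : 𝓢'(ℝ, ℂ)) : 𝓢'(ℝ, ℂ) :=
  TemperedDistribution.fourierMultiplierCLM ℂ (dyadicSymbol χ φ j) u

/-- The `L^p` norm of a tempered distribution: the norm of the `L^p` function that represents it,
and `∞` if it is not given by an `L^p` function. -/
noncomputable def distLpNorm (p : ℝ≥0∞) [Fact (1 ≤ p)] (u : 𝓢'(ℝ, ℂ)) : ℝ≥0∞ :=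
  ⨅ (f : Lp ℂ p (volume : Measure ℝ)) (_ : Lp.toTemperedDistribution f = u), ‖f‖ₑ

/-- The nonhomogeneous Besov norm: the `ℓ^r(ℤ)` norm of `(2^{js} ‖Δ_j u‖_{L^p})_j`, with values
in `[0, ∞]`. -/
noncomputable def besovNorm (χ φ : ℝ → ℝ) (s : ℝ) (p r : ℝ≥0∞) [Fact (1 ≤ p)]
    (u : 𝓢'(ℝ, ℂ)) : ℝ≥0∞ :=
  eLpNorm (fun j : ℤ => (2 : ℝ≥0∞) ^ ((j : ℝ) * s) * distLpNorm p (dyadicBlock χ φ j u)) r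
    Measure.count

/-- Membership in the nonhomogeneous Besov space `B^s_{p,r}(ℝ)`. -/
def MemBesov (χ φ : ℝ → ℝ) (s : ℝ) (p r : ℝ≥0∞) [Fact (1 ≤ p)] (u : 𝓢'(ℝ, ℂ)) : Prop :=
  besovNorm χ φ s p r u < ⊤

/-- `P` is the product of `S` and `T`, where `S` is (given by) a smooth function `f` all of whose
derivatives have at most polynomial growth: `⟨P, g⟩ = ⟨T, f g⟩` for every Schwartz function `g`.
The function `f` is determined by `S`, hence `P` is determined by `S` and `T`. -/
def IsSmoothProduct (S T P : 𝓢'(ℝ, ℂ)) : Prop :=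
  ∃ (f : ℝ → ℂ) (hf : f.HasTemperateGrowth),
    S = Function.HasTemperateGrowth.toTemperedDistribution volume hf ∧
    P = TemperedDistribution.smulLeftCLM ℂ f T

/-- `w` is the product `uv = ∑_{j', j} Δ_{j'} u Δ_j v` of two tempered distributions: each block
`Δ_{j'} u` is a smooth function of polynomial growth that multiplies `Δ_j v`, and the double
series of these products converges unconditionally to `w` in the space of tempered distributions
(that is, tested against each Schwartz function). -/
def IsDistProduct (χ φ : ℝ → ℝ) (u v w : 𝓢'(ℝ, ℂ)) : Prop :=
  ∃ P : ℤ × ℤ → 𝓢'(ℝ, ℂ),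
    (∀ i j : ℤ, IsSmoothProduct (dyadicBlock χ φ i u) (dyadicBlock χ φ j v) (P (i, j))) ∧
    HasSum P w

/-! Put `q = max p 2`, so that `q ≥ p` and `q ≥ 2`, and `m = q / 2`, so that `1 ≤ m ≤ p`. By
Bernstein's inequality the blocks of `u` and `v` lie in `L^q`, and with `τ = s - 2 - 1/p + 1/q` the
sequence `2^{jθ} ‖Δ_j u‖_{L^q}` is square summable whenever `θ < τ`, or `θ = τ` and `r ≤ 2`. The
hypotheses on `s` say exactly that some such `θ ≥ 0` exists: `τ > 0` in the first case, `θ = τ = 0`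
in the endpoint case. By Hölder, each product `Δ_i u Δ_j v` lies in `L^m`.

Convergence. The pairs with `|i - j| ≤ 2` are absolutely summable in `L^m` by Cauchy-Schwarz. For
the other pairs the spectrum of the product lies in an annulus of size `2^{max i j}`; dividing by
the frequency and moving a derivative onto the test function gains `2^{-max i j}`, which sums over
both indices (`exists_norm_product_apply_le`, `tsum_productDecay_ne_top`).

Estimate. The block `Δ_k` sees only pairs with `max i j ≥ k - 2` that are near the diagonal or lie
in a box of `(k + 4)^2` pairs. Hence the `L^m` norms add up to `O(k^2 2^{-kθ})`, and Bernstein from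
`L^m` to `L^p` costs `2^{k(2/q - 1/p)}` (`exists_isDistProduct`). After weighting by `2^{k(s - 3)}`
the exponent at `θ = τ` is `1/q - 1 ≤ -1/2`. This slack absorbs the quadratic factor, a small loss
in `θ`, and the passage from `ℓ^r` to `ℓ^1` (`besov_product`). -/

/-! ### Convolution of a Schwartz kernel with a function of weighted integrability -/

section Convolution

/-- The convolution of a Schwartz function with a function on the line. -/
noncomputable def schwartzConv (K : 𝓢(ℝ, ℂ)) (f : ℝ → ℂ) (y : ℝ) : ℂ :=
  ∫ x, K (y - x) * f x

theorem one_add_norm_le_mul (x y : ℝ) : 1 + ‖x‖ ≤ (1 + ‖y‖) * (1 + ‖y - x‖) := by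
  have h : ‖x‖ ≤ ‖y‖ + ‖y - x‖ := by
    calc ‖x‖ = ‖y - (y - x)‖ := by congr 1; ring
      _ ≤ _ := norm_sub_le _ _
  nlinarith [mul_nonneg (norm_nonneg y) (norm_nonneg (y - x))]

/-- Peetre's inequality separates the two variables, so one integrable weight in `x` dominates all
translates of the kernel. -/
theorem exists_schwartz_translate_bound (K : 𝓢(ℝ, ℂ)) (k : ℕ) :
    ∃ C : ℝ, 0 ≤ C ∧ ∀ x y : ℝ, ‖K (y - x)‖ ≤ C * (1 + ‖y‖) ^ k * ((1 + ‖x‖) ^ k)⁻¹ := by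
  refine ⟨2 ^ k * (Finset.Iic (k, 0)).sup (fun m => SchwartzMap.seminorm ℝ m.1 m.2) K,
    by positivity, fun x y => ?_⟩
  have h := SchwartzMap.one_add_le_sup_seminorm_apply (𝕜 := ℝ) (m := (k, 0)) (le_refl k)
    (le_refl 0) K (y - x)
  simp only [norm_iteratedFDeriv_zero] at h
  set D := 2 ^ k * (Finset.Iic (k, 0)).sup (fun m => SchwartzMap.seminorm ℝ m.1 m.2) K
  have hx : 0 < (1 + ‖x‖) ^ k := by positivity
  rw [← div_eq_mul_inv, le_div_iff₀ hx]
  calc ‖K (y - x)‖ * (1 + ‖x‖) ^ k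
      ≤ ‖K (y - x)‖ * ((1 + ‖y‖) * (1 + ‖y - x‖)) ^ k := by
        gcongr; exact one_add_norm_le_mul x y
    _ = ((1 + ‖y - x‖) ^ k * ‖K (y - x)‖) * (1 + ‖y‖) ^ k := by rw [mul_pow]; ring
    _ ≤ D * (1 + ‖y‖) ^ k := by gcongr

/-- Hölder: the weight lies in the conjugate space `L^{a'}`, `a' = (1 - a⁻¹)⁻¹`, once `k` is large.
-/
theorem exists_integrable_weight {a : ℝ≥0∞} [ha : Fact (1 ≤ a)] {f : ℝ → ℂ} (hf : MemLp f a) :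
    ∃ k : ℕ, Integrable fun x : ℝ => ((1 + ‖x‖) ^ k)⁻¹ * ‖f x‖ := by
  have := ENNReal.HolderConjugate.inv_one_sub_inv' ha.out
  obtain ⟨k, hk⟩ := (inferInstance : (volume : Measure ℝ).HasTemperateGrowth).exists_eLpNorm_lt_top
    ((1 - a⁻¹)⁻¹)
  refine ⟨k, ?_⟩
  have h1 : MemLp (fun x : ℝ => (1 + ‖x‖) ^ (-k : ℝ)) ((1 - a⁻¹)⁻¹) := by
    refine ⟨Continuous.aestronglyMeasurable ?_, hk⟩
    exact .rpow_const (by fun_prop) fun x => .inl (by positivity)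
  have h2 := MemLp.integrable_mul h1 hf.norm
  refine h2.congr (.of_forall fun x => ?_)
  simp

variable {f : ℝ → ℂ} {k : ℕ}

theorem integrable_schwartzConv_integrand (hm : AEStronglyMeasurable f)
    (hf : Integrable fun x : ℝ => ((1 + ‖x‖) ^ k)⁻¹ * ‖f x‖) (K : 𝓢(ℝ, ℂ)) (y : ℝ) :
    Integrable fun x => K (y - x) * f x := by
  obtain ⟨C, hC, hb⟩ := exists_schwartz_translate_bound K k
  refine (hf.const_mul (C * (1 + ‖y‖) ^ k)).mono' ?_ (.of_forall fun x => ?_)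
  · exact (K.continuous.comp (by fun_prop)).aestronglyMeasurable.mul hm
  · rw [norm_mul, ← mul_assoc]
    exact mul_le_mul_of_nonneg_right (hb x y) (norm_nonneg _)

theorem exists_norm_schwartzConv_le
    (hf : Integrable fun x : ℝ => ((1 + ‖x‖) ^ k)⁻¹ * ‖f x‖) (K : 𝓢(ℝ, ℂ)) :
    ∃ C : ℝ, ∀ y, ‖schwartzConv K f y‖ ≤ C * (1 + ‖y‖) ^ k := by
  obtain ⟨C, hC, hb⟩ := exists_schwartz_translate_bound K k
  refine ⟨C * ∫ x : ℝ, ((1 + ‖x‖) ^ k)⁻¹ * ‖f x‖, fun y => ?_⟩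
  calc ‖schwartzConv K f y‖ ≤ ∫ x : ℝ, (C * (1 + ‖y‖) ^ k) * (((1 + ‖x‖) ^ k)⁻¹ * ‖f x‖) := by
        refine norm_integral_le_of_norm_le (hf.const_mul _) (.of_forall fun x => ?_)
        rw [norm_mul, ← mul_assoc]
        exact mul_le_mul_of_nonneg_right (hb x y) (norm_nonneg _)
    _ = _ := by rw [integral_const_mul]; ring

theorem hasDerivAt_schwartzConv (hm : AEStronglyMeasurable f)
    (hf : Integrable fun x : ℝ => ((1 + ‖x‖) ^ k)⁻¹ * ‖f x‖) (K : 𝓢(ℝ, ℂ)) (y : ℝ) :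
    HasDerivAt (schwartzConv K f) (schwartzConv (SchwartzMap.derivCLM ℝ ℂ K) f y) y := by
  obtain ⟨C, hC, hb⟩ := exists_schwartz_translate_bound (SchwartzMap.derivCLM ℝ ℂ K) k
  refine (hasDerivAt_integral_of_dominated_loc_of_deriv_le
    (F := fun y x => K (y - x) * f x)
    (F' := fun y x => (SchwartzMap.derivCLM ℝ ℂ K) (y - x) * f x)
    (bound := fun x => (C * (2 + ‖y‖) ^ k) * (((1 + ‖x‖) ^ k)⁻¹ * ‖f x‖))
    (Metric.ball_mem_nhds y one_pos) (.of_forall fun z => ?_) ?_ ?_ (.of_forall fun x z hz => ?_)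
    (hf.const_mul _) (.of_forall fun x z _ => ?_)).2
  · exact (integrable_schwartzConv_integrand hm hf K z).aestronglyMeasurable
  · exact integrable_schwartzConv_integrand hm hf K y
  · exact (integrable_schwartzConv_integrand hm hf _ y).aestronglyMeasurable
  · rw [norm_mul, ← mul_assoc]
    refine mul_le_mul_of_nonneg_right ((hb x z).trans ?_) (norm_nonneg _)
    have : ‖z‖ ≤ 1 + ‖y‖ := by
      have h1 : ‖z - y‖ < 1 := by simpa [dist_eq_norm] using hz
      have h2 : ‖z‖ ≤ ‖z - y‖ + ‖y‖ := by simpa using norm_add_le (z - y) y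
      linarith
    have h3 : 1 + ‖z‖ ≤ 2 + ‖y‖ := by linarith
    gcongr
  · have h := (K.hasDerivAt (z - x)).comp_sub_const z x
    simpa [SchwartzMap.derivCLM_apply] using h.mul_const (f x)

/-- Every derivative falls on the kernel, which stays Schwartz, so the same growth exponent `k`
serves at all orders. -/
theorem hasTemperateGrowth_schwartzConv (hm : AEStronglyMeasurable f)
    (hf : Integrable fun x : ℝ => ((1 + ‖x‖) ^ k)⁻¹ * ‖f x‖) (K : 𝓢(ℝ, ℂ)) :
    (schwartzConv K f).HasTemperateGrowth := by
  have hder : ∀ K : 𝓢(ℝ, ℂ), deriv (schwartzConv K f) =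
      schwartzConv (SchwartzMap.derivCLM ℝ ℂ K) f := fun K =>
    funext fun y => (hasDerivAt_schwartzConv hm hf K y).deriv
  refine ⟨?_, fun n => ?_⟩
  · rw [contDiff_infty]
    intro n
    induction n generalizing K with
    | zero =>
      exact contDiff_zero.2 (continuous_iff_continuousAt.2 fun y =>
        (hasDerivAt_schwartzConv hm hf K y).continuousAt)
    | succ n ih =>
      push_cast
      refine contDiff_succ_iff_deriv.2 ⟨fun y =>
        (hasDerivAt_schwartzConv hm hf K y).differentiableAt, by simp, ?_⟩
      rw [hder]
      exact ih _
  · have : ∃ C : ℝ, ∀ y, ‖iteratedDeriv n (schwartzConv K f) y‖ ≤ C * (1 + ‖y‖) ^ k := by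
      induction n generalizing K with
      | zero => simpa using exists_norm_schwartzConv_le hf K
      | succ n ih => simpa only [iteratedDeriv_succ', hder] using ih _
    obtain ⟨C, hC⟩ := this
    exact ⟨k, C, fun y => by simpa only [norm_iteratedFDeriv_eq_norm_iteratedDeriv] using hC y⟩

open scoped FourierTransform Convolution in
theorem fourier_smulLeft_fourierInv_apply (K g : 𝓢(ℝ, ℂ)) (x : ℝ) :
    (𝓕 (SchwartzMap.smulLeftCLM ℂ (𝓕 K : 𝓢(ℝ, ℂ)) (𝓕⁻ g))) x = ∫ y, g y * K (y - x) := by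
  -- With `G` the reflection of `g`, `𝓕⁻ g = 𝓕 G`, and the convolution theorem applies to `K` and
  -- `G`.
  set G : 𝓢(ℝ, ℂ) := SchwartzMap.compCLMOfContinuousLinearEquiv ℂ (.neg ℝ) g with hG
  have h1 : SchwartzMap.smulLeftCLM ℂ (𝓕 K : 𝓢(ℝ, ℂ)) (𝓕⁻ g) =
      SchwartzMap.pairing (ContinuousLinearMap.mul ℂ ℂ) (𝓕 K) (𝓕 G) := by
    ext ξ
    rw [SchwartzMap.smulLeftCLM_apply_apply (SchwartzMap.hasTemperateGrowth _),
      SchwartzMap.pairing_apply_apply, SchwartzMap.fourierInv_coe,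
      Real.fourierInv_eq_fourier_comp_neg]
    rfl
  have h2 : (𝓕 (SchwartzMap.smulLeftCLM ℂ (𝓕 K : 𝓢(ℝ, ℂ)) (𝓕⁻ g))) x =
      (𝓕⁻ (SchwartzMap.pairing (ContinuousLinearMap.mul ℂ ℂ) (𝓕 K) (𝓕 G)) : 𝓢(ℝ, ℂ)) (-x) := by
    rw [h1, SchwartzMap.fourierInv_coe, SchwartzMap.fourier_coe,
      Real.fourierInv_eq_fourier_neg, neg_neg]
  rw [h2, ← SchwartzMap.fourier_convolution, FourierTransform.fourierInv_fourier_eq,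
    SchwartzMap.convolution_apply, convolution_def,
    ← integral_sub_right_eq_self _ x]
  refine integral_congr_ae (.of_forall fun t => ?_)
  simp [hG, mul_comm]

open scoped FourierTransform in
theorem fourierMultiplierCLM_toTemperedDistribution_apply {a : ℝ≥0∞} [Fact (1 ≤ a)]
    (K g : 𝓢(ℝ, ℂ)) (f : Lp ℂ a (volume : Measure ℝ)) :
    TemperedDistribution.fourierMultiplierCLM ℂ (𝓕 K : 𝓢(ℝ, ℂ)) (Lp.toTemperedDistribution f) g =
      ∫ y, g y • schwartzConv K f y := by
  obtain ⟨k, hk⟩ := exists_integrable_weight (Lp.memLp f)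
  have hm := (Lp.memLp f).aestronglyMeasurable
  rw [TemperedDistribution.fourierMultiplierCLM_apply_apply, Lp.toTemperedDistribution_apply]
  simp_rw [fourier_smulLeft_fourierInv_apply, smul_eq_mul, ← integral_mul_const]
  rw [integral_integral_swap]
  · refine integral_congr_ae (.of_forall fun y => ?_)
    simp_rw [mul_assoc]
    rw [integral_const_mul]
    rfl
  · obtain ⟨C, hC, hb⟩ := exists_schwartz_translate_bound K k
    have hg : Integrable fun y : ℝ => C * ((1 + ‖y‖) ^ k * ‖g y‖) := by
      refine Integrable.const_mul ?_ C
      have h1 : Integrable fun y : ℝ => 2 ^ k * (‖g y‖ + ‖y‖ ^ k * ‖g y‖) :=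
        (g.integrable.norm.add (SchwartzMap.integrable_pow_mul volume g k)).const_mul _
      refine h1.mono' (by fun_prop) (.of_forall fun y => ?_)
      rw [Real.norm_of_nonneg (by positivity)]
      have h2 : (1 + ‖y‖) ^ k ≤ 2 ^ k * (1 + ‖y‖ ^ k) := by
        refine (add_pow_le zero_le_one (norm_nonneg y) k).trans ?_
        rw [one_pow]
        gcongr
        · exact one_le_two
        · exact Nat.sub_le k 1
      nlinarith [norm_nonneg (g y)]
    refine (hk.mul_prod hg).mono' ?_ (.of_forall fun z => ?_)
    · refine AEStronglyMeasurable.mul (Continuous.aestronglyMeasurable ?_) hm.comp_fst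
      fun_prop
    · obtain ⟨x, y⟩ := z
      simp only [Function.uncurry, norm_mul]
      calc ‖g y‖ * ‖K (y - x)‖ * ‖f x‖
          ≤ ‖g y‖ * (C * (1 + ‖y‖) ^ k * ((1 + ‖x‖) ^ k)⁻¹) * ‖f x‖ := by gcongr; exact hb x y
        _ = _ := by ring

end Convolution

/-! ### Young and Bernstein inequalities -/

section Young

/-- Interpolation between `L^a` and `L^∞`: `|h|^b ≤ (sup |h|)^{b - a} |h|^a`. For Bernstein `t` is
the frequency scale; for sequences `t = 1`. -/
theorem eLpNorm_le_of_bound_of_eLpNorm_le {X E : Type*} [MeasurableSpace X] {μ : Measure X}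
    [TopologicalSpace E] [ContinuousENorm E] {h : X → E} {a b : ℝ≥0∞} (ha : a ≠ 0) (hab : a ≤ b)
    {D t : ℝ≥0∞} (hD : D ≠ ⊤) (ht' : t ≠ ⊤) (hsup : ∀ x, ‖h x‖ₑ ≤ D * t ^ a⁻¹.toReal)
    (hLp : eLpNorm h a μ ≤ D) : eLpNorm h b μ ≤ D * t ^ (a⁻¹.toReal - b⁻¹.toReal) := by
  rcases eq_or_ne b ⊤ with rfl | hb
  · simp only [ENNReal.inv_top, ENNReal.toReal_zero, sub_zero, eLpNorm_exponent_top]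
    exact essSup_le_of_ae_le _ (.of_forall hsup)
  have ha' : a ≠ ⊤ := ne_top_of_le_ne_top hb hab
  have hb0 : b ≠ 0 := (lt_of_lt_of_le (pos_iff_ne_zero.2 ha) hab).ne'
  have hα : 0 < a.toReal := ENNReal.toReal_pos ha ha'
  have hβ : 0 < b.toReal := ENNReal.toReal_pos hb0 hb
  have hle : a.toReal ≤ b.toReal := ENNReal.toReal_mono hb hab
  rw [eLpNorm_eq_lintegral_rpow_enorm_toReal ha ha', one_div,
    ENNReal.rpow_inv_le_iff hα] at hLp
  rw [eLpNorm_eq_lintegral_rpow_enorm_toReal hb0 hb, one_div, ENNReal.rpow_inv_le_iff hβ]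
  simp only [ENNReal.toReal_inv] at *
  set α := a.toReal
  set β := b.toReal
  have h0 : 0 ≤ β - α := by linarith
  calc ∫⁻ x, ‖h x‖ₑ ^ β ∂μ
      ≤ ∫⁻ x, (D * t ^ α⁻¹) ^ (β - α) * ‖h x‖ₑ ^ α ∂μ := by
        refine lintegral_mono fun x => ?_
        calc ‖h x‖ₑ ^ β = ‖h x‖ₑ ^ (β - α) * ‖h x‖ₑ ^ α := by
              rw [← ENNReal.rpow_add_of_nonneg _ _ h0 hα.le, sub_add_cancel]
          _ ≤ _ := by gcongr; exact hsup x
    _ ≤ (D * t ^ α⁻¹) ^ (β - α) * ∫⁻ x, ‖h x‖ₑ ^ α ∂μ := by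
        rw [lintegral_const_mul']
        exact ENNReal.rpow_ne_top_of_nonneg h0 (ENNReal.mul_ne_top hD
          (ENNReal.rpow_ne_top_of_nonneg (by positivity) ht'))
    _ ≤ (D * t ^ α⁻¹) ^ (β - α) * D ^ α := by gcongr
    _ = (D * t ^ (α⁻¹ - β⁻¹)) ^ β := by
        rw [ENNReal.mul_rpow_of_nonneg _ _ h0, ENNReal.mul_rpow_of_nonneg _ _ hβ.le,
          mul_right_comm, ← ENNReal.rpow_add_of_nonneg _ _ h0 hα.le, ← ENNReal.rpow_mul,
          ← ENNReal.rpow_mul, sub_add_cancel]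
        congr 2
        field_simp

variable {K : 𝓢(ℝ, ℂ)} {f : ℝ → ℂ} {a C t : ℝ≥0∞}

theorem enorm_schwartzConv_le_lintegral (K : 𝓢(ℝ, ℂ)) (f : ℝ → ℂ) (y : ℝ) :
    ‖schwartzConv K f y‖ₑ ≤ ∫⁻ x, ‖K (y - x)‖ₑ * ‖f x‖ₑ :=
  (enorm_integral_le_lintegral_enorm _).trans_eq (by simp_rw [enorm_mul])

/-- Jensen's inequality for the measure `|K(y - x)| dx`, whose mass is at most `C`. Both the sup
bound and Young's inequality follow from it. -/
theorem enorm_schwartzConv_le_withDensity (hm : AEStronglyMeasurable f) (ha : 1 ≤ a)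
    (hI : ∫⁻ x, ‖K x‖ₑ ≤ C) (y : ℝ) :
    ‖schwartzConv K f y‖ₑ ≤
      eLpNorm f a (volume.withDensity fun x => ‖K (y - x)‖ₑ) * C ^ (1 - a⁻¹.toReal) := by
  have hK : Measurable fun x => ‖K (y - x)‖ₑ :=
    (K.continuous.comp (continuous_const.sub continuous_id)).measurable.enorm
  have ha1 : a⁻¹.toReal ≤ 1 := by
    simpa using ENNReal.toReal_mono ENNReal.one_ne_top (ENNReal.inv_le_one.2 ha)
  have h1 := eLpNorm_le_eLpNorm_mul_rpow_measure_univ ha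
    (hm.mono_ac (withDensity_absolutelyContinuous volume fun x => ‖K (y - x)‖ₑ))
  rw [eLpNorm_one_eq_lintegral_enorm, lintegral_withDensity_eq_lintegral_mul₀ hK.aemeasurable
    hm.enorm, withDensity_apply _ .univ, Measure.restrict_univ,
    lintegral_sub_left_eq_self (fun x => ‖K x‖ₑ) y] at h1
  refine (enorm_schwartzConv_le_lintegral K f y).trans (h1.trans ?_)
  gcongr
  simpa [ENNReal.toReal_inv] using ENNReal.rpow_le_rpow hI (sub_nonneg.2 ha1)

/-- The density `|K(y - x)|` is at most `C t`, so the norm for the weighted measure is at most `(C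
t)^{1/a}` times the Lebesgue norm. -/
theorem enorm_schwartzConv_le (hm : AEStronglyMeasurable f) (ha : 1 ≤ a)
    (hI : ∫⁻ x, ‖K x‖ₑ ≤ C) (hS : ∀ x, ‖K x‖ₑ ≤ C * t) (y : ℝ) :
    ‖schwartzConv K f y‖ₑ ≤ C * eLpNorm f a * t ^ a⁻¹.toReal := by
  have ha1 : a⁻¹.toReal ≤ 1 := by
    simpa using ENNReal.toReal_mono ENNReal.one_ne_top (ENNReal.inv_le_one.2 ha)
  have hle : eLpNorm f a (volume.withDensity fun x => ‖K (y - x)‖ₑ) ≤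
      (C * t) ^ a⁻¹.toReal * eLpNorm f a := by
    rcases eq_or_ne a ⊤ with rfl | hat
    · simpa using eLpNormEssSup_mono_measure f
        (withDensity_absolutelyContinuous volume fun x => ‖K (y - x)‖ₑ)
    · have h1 : (volume.withDensity fun x => ‖K (y - x)‖ₑ) ≤ (C * t) • (volume : Measure ℝ) := by
        rw [← withDensity_const]
        exact withDensity_mono (.of_forall fun x => hS _)
      refine (eLpNorm_mono_measure f h1).trans_eq ?_
      rw [eLpNorm_smul_measure_of_ne_top hat, one_div, smul_eq_mul]
  refine (enorm_schwartzConv_le_withDensity hm ha hI y).trans ?_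
  calc _ ≤ (C * t) ^ a⁻¹.toReal * eLpNorm f a * C ^ (1 - a⁻¹.toReal) := by gcongr
    _ = C ^ (a⁻¹.toReal + (1 - a⁻¹.toReal)) * eLpNorm f a * t ^ a⁻¹.toReal := by
      rw [ENNReal.rpow_add_of_nonneg _ _ ENNReal.toReal_nonneg (sub_nonneg.2 ha1),
        ENNReal.mul_rpow_of_nonneg _ _ ENNReal.toReal_nonneg]
      ring
    _ = _ := by simp

/-- The pointwise Jensen bound, raised to the power `a` and integrated in `y` by Tonelli. -/
theorem eLpNorm_schwartzConv_le (hm : AEStronglyMeasurable f) (ha : 1 ≤ a) (hC : C ≠ ⊤)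
    (hI : ∫⁻ x, ‖K x‖ₑ ≤ C) : eLpNorm (schwartzConv K f) a ≤ C * eLpNorm f a := by
  rcases eq_or_ne a ⊤ with rfl | hat
  · rw [eLpNorm_exponent_top]
    refine essSup_le_of_ae_le _ (.of_forall fun y => ?_)
    refine (enorm_schwartzConv_le_withDensity hm ha hI y).trans ?_
    simp only [ENNReal.inv_top, ENNReal.toReal_zero, sub_zero, ENNReal.rpow_one,
      eLpNorm_exponent_top]
    rw [mul_comm]
    gcongr
    exact withDensity_absolutelyContinuous _ _
  have ha0 : a ≠ 0 := (zero_lt_one.trans_le ha).ne'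
  have hα : 0 < a.toReal := ENNReal.toReal_pos ha0 hat
  have hα1 : 1 ≤ a.toReal := by simpa using ENNReal.toReal_mono hat ha
  have hK : Measurable fun x => ‖K x‖ₑ := K.continuous.measurable.enorm
  have hK' : ∀ y, Measurable fun x => ‖K (y - x)‖ₑ := fun y =>
    hK.comp (measurable_const.sub measurable_id)
  have hK'' : ∀ x, Measurable fun y => ‖K (y - x)‖ₑ := fun x =>
    hK.comp (measurable_id.sub measurable_const)
  have hpt : ∀ y, ‖schwartzConv K f y‖ₑ ^ a.toReal ≤
      C ^ (a.toReal - 1) * ∫⁻ x, ‖K (y - x)‖ₑ * ‖f x‖ₑ ^ a.toReal := fun y => by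
    have h := ENNReal.rpow_le_rpow (enorm_schwartzConv_le_withDensity hm ha hI y) hα.le
    rw [eLpNorm_eq_lintegral_rpow_enorm_toReal ha0 hat, ENNReal.mul_rpow_of_nonneg _ _ hα.le,
      ← ENNReal.rpow_mul, one_div, inv_mul_cancel₀ hα.ne', ENNReal.rpow_one,
      lintegral_withDensity_eq_lintegral_mul₀ (hK' y).aemeasurable
      (hm.enorm.pow_const _), ← ENNReal.rpow_mul, sub_mul, ENNReal.toReal_inv,
      inv_mul_cancel₀ hα.ne', one_mul, mul_comm] at h
    exact h
  rw [eLpNorm_eq_lintegral_rpow_enorm_toReal ha0 hat, one_div, ENNReal.rpow_inv_le_iff hα,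
    ENNReal.mul_rpow_of_nonneg _ _ hα.le, eLpNorm_eq_lintegral_rpow_enorm_toReal ha0 hat,
    ← ENNReal.rpow_mul, one_div, inv_mul_cancel₀ hα.ne', ENNReal.rpow_one]
  calc ∫⁻ y, ‖schwartzConv K f y‖ₑ ^ a.toReal
      ≤ ∫⁻ y, C ^ (a.toReal - 1) * ∫⁻ x, ‖K (y - x)‖ₑ * ‖f x‖ₑ ^ a.toReal := lintegral_mono hpt
    _ = C ^ (a.toReal - 1) * ∫⁻ x, ∫⁻ y, ‖K (y - x)‖ₑ * ‖f x‖ₑ ^ a.toReal := by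
        rw [lintegral_const_mul' _ _ (ENNReal.rpow_ne_top_of_nonneg (by linarith) hC),
          lintegral_lintegral_swap]
        exact (hK.comp (by fun_prop)).aemeasurable.mul (hm.enorm.pow_const _).comp_snd
    _ ≤ C ^ (a.toReal - 1) * ∫⁻ x, C * ‖f x‖ₑ ^ a.toReal := by
        gcongr with x
        rw [lintegral_mul_const _ (hK'' x),
          lintegral_sub_right_eq_self (fun y => ‖K y‖ₑ) x]
        gcongr
    _ = _ := by
        rw [lintegral_const_mul' _ _ hC, ← mul_assoc]
        congr 1
        conv_lhs => rw [← ENNReal.rpow_one C, ← ENNReal.rpow_mul, one_mul]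
        rw [← ENNReal.rpow_add_of_nonneg _ _ (by linarith) zero_le_one, sub_add_cancel]

open scoped FourierTransform in
theorem exists_dilated_kernel (M : 𝓢(ℝ, ℂ)) : ∃ C : ℝ≥0, ∀ l : ℝ, 0 < l → ∃ K : 𝓢(ℝ, ℂ),
    (⇑(𝓕 K : 𝓢(ℝ, ℂ)) = fun ξ => M (l⁻¹ * ξ)) ∧ ∫⁻ x, ‖K x‖ₑ ≤ C ∧
      ∀ x, ‖K x‖ₑ ≤ C * ENNReal.ofReal l := by
  set N : 𝓢(ℝ, ℂ) := 𝓕⁻ M with hN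
  have hint : ∫⁻ x, ‖N x‖ₑ ≠ ⊤ := N.integrable.2.ne
  set S := SchwartzMap.seminorm ℝ 0 0 N
  have hsup : ∀ x, ‖N x‖ₑ ≤ S.toNNReal := fun x => by
    rw [← ofReal_norm]
    exact ENNReal.ofReal_le_ofReal (SchwartzMap.norm_le_seminorm ℝ N x)
  refine ⟨max (∫⁻ x, ‖N x‖ₑ).toNNReal S.toNNReal, fun l hl => ?_⟩
  let e : ℝ ≃L[ℝ] ℝ := ContinuousLinearEquiv.unitsEquivAut ℝ (Units.mk0 l hl.ne')
  have he : ∀ x, e x = l * x := fun x => by simp [e, mul_comm]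
  -- The `L^1`-normalized dilation `l N(l x)`: its `L^1` norm does not depend on `l`, its supremum
  -- grows like `l`.
  set K : 𝓢(ℝ, ℂ) := (l : ℂ) • SchwartzMap.compCLMOfContinuousLinearEquiv ℂ e N with hK
  have hKa : ∀ x, K x = l * N (l * x) := fun x => by simp [hK, he]
  refine ⟨K, ?_, ?_, fun x => ?_⟩
  · have hM : M = 𝓕 N := by simp [hN]
    ext ξ
    rw [hM, SchwartzMap.fourier_coe, SchwartzMap.fourier_coe, Real.fourier_eq', Real.fourier_eq']
    have := Measure.integral_comp_mul_left (fun y => Complex.exp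
      (↑(-2 * Real.pi * inner ℝ y (l⁻¹ * ξ)) * Complex.I) • N y) l
    rw [abs_of_pos (inv_pos.2 hl)] at this
    rw [← smul_right_injective ℂ (inv_ne_zero hl.ne') |>.eq_iff]
    rw [← this, ← integral_smul]
    refine integral_congr_ae (.of_forall fun x => ?_)
    have h1 : inner ℝ (l * x) (l⁻¹ * ξ) = inner ℝ x ξ := by
      simp only [RCLike.inner_apply, conj_trivial]
      field_simp
    have h2 : (l : ℂ) ≠ 0 := by exact_mod_cast hl.ne'
    simp only [h1, hKa, smul_eq_mul, Complex.real_smul, Complex.ofReal_inv]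
    field_simp
  · have h1 : ∫⁻ x, ‖K x‖ₑ = ∫⁻ x, ‖N x‖ₑ := by
      simp_rw [hKa, enorm_mul]
      rw [lintegral_const_mul' _ _ (by simp)]
      conv_rhs => rw [← Real.smul_map_volume_mul_left hl.ne', lintegral_smul_measure,
        lintegral_map N.continuous.measurable.enorm (by fun_prop)]
      rw [abs_of_pos hl, smul_eq_mul]
      congr 1
      simp [← ofReal_norm, abs_of_pos hl]
    rw [h1]
    simp [ENNReal.coe_toNNReal hint]
  · rw [hKa, enorm_mul, mul_comm]
    gcongr
    · exact (hsup _).trans (by simp)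
    · simp [← ofReal_norm, abs_of_pos hl]

/-- **Bernstein's inequality.** A Fourier multiplier with a dilated Schwartz symbol maps `L^a` to
smooth functions in `L^b` for all `b ≥ a`. -/
theorem exists_bernstein (M : 𝓢(ℝ, ℂ)) : ∃ C : ℝ≥0, ∀ l : ℝ, 0 < l →
    ∀ (a : ℝ≥0∞) [Fact (1 ≤ a)] (f : Lp ℂ a (volume : Measure ℝ)),
    ∃ (F : ℝ → ℂ) (hF : F.HasTemperateGrowth),
      TemperedDistribution.fourierMultiplierCLM ℂ (fun ξ => M (l⁻¹ * ξ))
        (Lp.toTemperedDistribution f) = hF.toTemperedDistribution volume ∧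
      ∀ b, a ≤ b → MemLp F b ∧
        eLpNorm F b ≤ C * ENNReal.ofReal l ^ (a⁻¹.toReal - b⁻¹.toReal) * ‖f‖ₑ := by
  obtain ⟨C, hC⟩ := exists_dilated_kernel M
  refine ⟨C, fun l hl a ha f => ?_⟩
  obtain ⟨K, hK, hI, hS⟩ := hC l hl
  have hm := (Lp.memLp f).aestronglyMeasurable
  obtain ⟨k, hk⟩ := exists_integrable_weight (Lp.memLp f)
  have hF := hasTemperateGrowth_schwartzConv hm hk K
  have hnorm : ∀ b, a ≤ b → eLpNorm (schwartzConv K f) b ≤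
      C * ENNReal.ofReal l ^ (a⁻¹.toReal - b⁻¹.toReal) * ‖f‖ₑ := fun b hab => by
    rw [mul_right_comm, Lp.enorm_def]
    exact eLpNorm_le_of_bound_of_eLpNorm_le (zero_lt_one.trans_le ha.out).ne' hab
      (ENNReal.mul_ne_top ENNReal.coe_ne_top (Lp.memLp f).eLpNorm_ne_top) ENNReal.ofReal_ne_top
      (enorm_schwartzConv_le hm ha.out hI hS)
      (eLpNorm_schwartzConv_le hm ha.out ENNReal.coe_ne_top hI)
  refine ⟨_, hF, ?_, fun b hab => ⟨⟨hF.1.continuous.aestronglyMeasurable,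
    (hnorm b hab).trans_lt ?_⟩, hnorm b hab⟩⟩
  · ext g
    rw [← hK, fourierMultiplierCLM_toTemperedDistribution_apply]
    rfl
  · refine ENNReal.mul_lt_top (ENNReal.mul_lt_top ENNReal.coe_lt_top ?_) (by simp)
    refine (ENNReal.rpow_ne_top_of_nonneg (sub_nonneg.2 ?_) ENNReal.ofReal_ne_top).lt_top
    exact ENNReal.toReal_mono (ENNReal.inv_ne_top.2 (zero_lt_one.trans_le ha.out).ne')
      (ENNReal.inv_le_inv.2 hab)

end Young

/-! ### Spectral localization of products -/

section Spectral

open scoped FourierTransform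

/-- Translating the inverse Fourier transform of a Schwartz function modulates the function. -/
theorem fourier_compSubConst_fourierInv_apply (h : 𝓢(ℝ, ℂ)) (ξ x : ℝ) :
    (𝓕 (SchwartzMap.compSubConstCLM ℂ (-ξ) (𝓕⁻ h)) : 𝓢(ℝ, ℂ)) x =
      Complex.exp (↑(2 * Real.pi * inner ℝ x ξ) * Complex.I) * h x := by
  have h1 : h x = (𝓕 (𝓕⁻ h) : 𝓢(ℝ, ℂ)) x := by simp
  rw [h1, SchwartzMap.fourier_coe, SchwartzMap.fourier_coe, Real.fourier_eq', Real.fourier_eq',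
    ← integral_const_mul, ← integral_sub_right_eq_self _ ξ]
  refine integral_congr_ae (.of_forall fun η => ?_)
  simp only [SchwartzMap.compSubConstCLM_apply, sub_neg_eq_add, sub_add_cancel, smul_eq_mul,
    ← mul_assoc, ← Complex.exp_add]
  congr 2
  simp only [RCLike.inner_apply, conj_trivial]
  push_cast
  ring

/-- The spectrum of a product is contained in the sum of the spectra. -/
theorem fourierMultiplierCLM_smulLeftCLM_eq_zero {m₁ m₂ m₃ G : ℝ → ℂ}
    (h₁ : m₁.HasTemperateGrowth) (h₂ : m₂.HasTemperateGrowth) (h₃ : m₃.HasTemperateGrowth)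
    (hG : G.HasTemperateGrowth) (u v : 𝓢'(ℝ, ℂ))
    (hv : TemperedDistribution.fourierMultiplierCLM ℂ m₂ v = hG.toTemperedDistribution volume)
    (h : ∀ ξ η, m₂ ξ ≠ 0 → m₃ η ≠ 0 → m₁ (ξ + η) = 0) :
    TemperedDistribution.fourierMultiplierCLM ℂ m₁ (TemperedDistribution.smulLeftCLM ℂ G
      (TemperedDistribution.fourierMultiplierCLM ℂ m₃ u)) = 0 := by
  ext g
  set k : 𝓢(ℝ, ℂ) := 𝓕 (SchwartzMap.smulLeftCLM ℂ m₁ (𝓕⁻ g)) with hk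
  have hkinv : ∀ ζ, (𝓕⁻ k : 𝓢(ℝ, ℂ)) ζ = m₁ ζ * (𝓕⁻ g : 𝓢(ℝ, ℂ)) ζ := fun ζ => by
    rw [hk, FourierTransform.fourierInv_fourier_eq, SchwartzMap.smulLeftCLM_apply_apply h₁,
      smul_eq_mul]
  -- By duality it is enough that the inverse transform of `G k` vanishes wherever `m₃` does not.
  suffices hz : SchwartzMap.smulLeftCLM ℂ m₃ (𝓕⁻ (SchwartzMap.smulLeftCLM ℂ G k)) = 0 by
    simp only [TemperedDistribution.fourierMultiplierCLM_apply_apply,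
      TemperedDistribution.smulLeftCLM_apply_apply, ← hk, hz]
    simp
  ext η
  rw [SchwartzMap.smulLeftCLM_apply_apply h₃]
  by_cases hη : m₃ η = 0
  · simp [hη]
  -- `k'` is `k` modulated by the frequency `η`. Its inverse transform carries the factor `m₁ (ξ +
  -- η)`, which vanishes where `m₂ ξ ≠ 0`; so `G`, being in the range of the multiplier `m₂`,
  -- annihilates `k'`. That pairing is the inverse transform of `G k` at `η`.
  set k' : 𝓢(ℝ, ℂ) := 𝓕 (SchwartzMap.compSubConstCLM ℂ (-η) (𝓕⁻ k)) with hk'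
  have h0 : TemperedDistribution.fourierMultiplierCLM ℂ m₂ v k' = 0 := by
    rw [TemperedDistribution.fourierMultiplierCLM_apply_apply]
    have : SchwartzMap.smulLeftCLM ℂ m₂ (𝓕⁻ k') = 0 := by
      ext ξ
      rw [SchwartzMap.smulLeftCLM_apply_apply h₂, hk', FourierTransform.fourierInv_fourier_eq,
        SchwartzMap.compSubConstCLM_apply, sub_neg_eq_add, hkinv]
      by_cases hξ : m₂ ξ = 0
      · simp [hξ]
      · simp [h ξ η hξ hη]
    rw [this]
    simp
  rw [hv] at h0
  change ∫ x, k' x • G x = 0 at h0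
  have h4 : (𝓕⁻ (SchwartzMap.smulLeftCLM ℂ G k) : 𝓢(ℝ, ℂ)) η = 0 := by
    rw [← h0, SchwartzMap.fourierInv_coe, Real.fourierInv_eq']
    refine integral_congr_ae (.of_forall fun x => ?_)
    simp only [hk', fourier_compSubConst_fourierInv_apply, smul_eq_mul]
    rw [SchwartzMap.smulLeftCLM_apply_apply hG, smul_eq_mul]
    ring
  simp [h4]

end Spectral

/-! ### Dyadic symbols -/

section Symbols

variable {χ φ : ℝ → ℝ}

theorem exists_schwartzMap_eq_ofReal_comp {m : ℝ → ℝ} (hm : ContDiff ℝ ∞ m) (R : ℝ)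
    (h : ∀ ξ, R < |ξ| → m ξ = 0) : ∃ M : 𝓢(ℝ, ℂ), ∀ ξ, M ξ = m ξ := by
  have hc : HasCompactSupport fun ξ => (m ξ : ℂ) := by
    refine HasCompactSupport.intro (isCompact_Icc (a := -R) (b := R)) fun ξ hξ => ?_
    rw [h ξ, Complex.ofReal_zero]
    by_contra! hle
    exact hξ (abs_le.1 hle)
  have hs : ContDiff ℝ ∞ fun ξ => (m ξ : ℂ) := Complex.ofRealCLM.contDiff.comp hm
  exact ⟨hc.toSchwartzMap hs, fun ξ => rfl⟩

namespace IsLittlewoodPaleyPair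

theorem low_eq_zero (h : IsLittlewoodPaleyPair χ φ) {ξ : ℝ} (hξ : 4 / 3 < |ξ|) : χ ξ = 0 := by
  by_contra h0
  have h1 : |ξ| ≤ 4 / 3 := h.tsupport_low (subset_tsupport χ h0)
  linarith

theorem high_ne_zero (h : IsLittlewoodPaleyPair χ φ) {ξ : ℝ} (hξ : φ ξ ≠ 0) :
    3 / 4 ≤ |ξ| ∧ |ξ| ≤ 8 / 3 :=
  h.tsupport_high (subset_tsupport φ hξ)

theorem dyadicSymbol_ne_zero (h : IsLittlewoodPaleyPair χ φ) {j : ℤ} {ξ : ℝ}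
    (hξ : dyadicSymbol χ φ j ξ ≠ 0) :
    -1 ≤ j ∧ |ξ| ≤ 8 / 3 * (2 : ℝ) ^ j ∧ (0 ≤ j → 3 / 4 * (2 : ℝ) ^ j ≤ |ξ|) := by
  unfold dyadicSymbol at hξ
  split_ifs at hξ with h1 h2
  · exact absurd rfl hξ
  · subst h2
    have : χ ξ ≠ 0 := by simpa using hξ
    have h3 : |ξ| ≤ 4 / 3 := by
      by_contra! h3
      exact this (h.low_eq_zero h3)
    refine ⟨le_rfl, h3.trans (by norm_num), by norm_num⟩
  · have h3 := h.high_ne_zero (by simpa using hξ)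
    have h4 : (0 : ℝ) < 2 ^ j := by positivity
    rw [abs_mul, abs_of_pos (inv_pos.2 h4), ← div_eq_inv_mul, le_div_iff₀ h4,
      div_le_iff₀ h4] at h3
    exact ⟨by omega, h3.2, fun _ => h3.1⟩

/-- The dyadic symbols are dilations of two fixed Schwartz functions. -/
theorem exists_dyadicSymbol_eq (h : IsLittlewoodPaleyPair χ φ) : ∃ M N : 𝓢(ℝ, ℂ),
    dyadicSymbol χ φ (-1) = (fun ξ => M (((2 : ℝ) ^ (-1 : ℤ))⁻¹ * ξ)) ∧
    ∀ j : ℤ, 0 ≤ j → dyadicSymbol χ φ j = fun ξ => N (((2 : ℝ) ^ j)⁻¹ * ξ) := by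
  -- The low block is attached to the scale `2^{-1}`, so its profile is `χ(ξ / 2)`.
  obtain ⟨M, hM⟩ := exists_schwartzMap_eq_ofReal_comp (m := fun ξ => χ (2⁻¹ * ξ))
    (h.contDiff_low.comp (by fun_prop)) (8 / 3) fun ξ hξ => h.low_eq_zero (by
      rw [abs_mul, abs_of_pos (by norm_num)]; linarith)
  obtain ⟨N, hN⟩ := exists_schwartzMap_eq_ofReal_comp h.contDiff_high (8 / 3) fun ξ hξ => by
    by_contra h0
    have := h.high_ne_zero h0
    linarith
  refine ⟨M, N, ?_, fun j hj => ?_⟩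
  · ext ξ
    simp [dyadicSymbol, hM]
  · ext ξ
    rw [hN, dyadicSymbol, if_neg (by omega), if_neg (by omega), zpow_neg]

theorem hasTemperateGrowth_dyadicSymbol (h : IsLittlewoodPaleyPair χ φ) (j : ℤ) :
    (dyadicSymbol χ φ j).HasTemperateGrowth := by
  obtain ⟨M, N, hM, hN⟩ := h.exists_dyadicSymbol_eq
  have key : ∀ (S : 𝓢(ℝ, ℂ)) (c : ℝ), (fun ξ : ℝ => S (c * ξ)).HasTemperateGrowth := fun S c =>
    S.hasTemperateGrowth.comp (ContinuousLinearMap.hasTemperateGrowth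
      (ContinuousLinearMap.mul ℝ ℝ c))
  rcases lt_trichotomy j (-1) with hj | rfl | hj
  · have : dyadicSymbol χ φ j = fun _ => 0 := by
      ext ξ
      rw [dyadicSymbol, if_pos (by omega)]
    rw [this]
    exact .zero
  · rw [hM]
    exact key _ _
  · rw [hN j (by omega)]
    exact key _ _

theorem dyadicBlock_of_le (χ φ : ℝ → ℝ) {j : ℤ} (hj : j ≤ -2) (u : 𝓢'(ℝ, ℂ)) :
    dyadicBlock χ φ j u = 0 := by
  have : dyadicSymbol χ φ j = fun _ => 0 := by
    ext ξ
    rw [dyadicSymbol, if_pos hj]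
  simp [dyadicBlock, this]

/-- Bernstein's inequality for the dyadic blocks. -/
theorem exists_bernstein_dyadicBlock (h : IsLittlewoodPaleyPair χ φ) : ∃ C : ℝ≥0, ∀ j : ℤ, -1 ≤ j →
    ∀ (a : ℝ≥0∞) [Fact (1 ≤ a)] (f : Lp ℂ a (volume : Measure ℝ)),
    ∃ (F : ℝ → ℂ) (hF : F.HasTemperateGrowth),
      dyadicBlock χ φ j (Lp.toTemperedDistribution f) = hF.toTemperedDistribution volume ∧
      ∀ b, a ≤ b → MemLp F b ∧ eLpNorm F b ≤
        C * ENNReal.ofReal (2 ^ j) ^ (a⁻¹.toReal - b⁻¹.toReal) * ‖f‖ₑ := by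
  obtain ⟨M, N, hM, hN⟩ := h.exists_dyadicSymbol_eq
  obtain ⟨C₁, hC₁⟩ := exists_bernstein M
  obtain ⟨C₂, hC₂⟩ := exists_bernstein N
  refine ⟨max C₁ C₂, fun j hj a ha f => ?_⟩
  rcases hj.eq_or_lt with rfl | hj
  · obtain ⟨F, hF, h1, h2⟩ := hC₁ (2 ^ (-1 : ℤ)) (by positivity) a f
    refine ⟨F, hF, by rw [← h1, dyadicBlock, hM], fun b hb => ⟨(h2 b hb).1, (h2 b hb).2.trans ?_⟩⟩
    gcongr
    exact le_max_left _ _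
  · obtain ⟨F, hF, h1, h2⟩ := hC₂ (2 ^ j) (by positivity) a f
    refine ⟨F, hF, by rw [← h1, dyadicBlock, hN j (by omega)],
      fun b hb => ⟨(h2 b hb).1, (h2 b hb).2.trans ?_⟩⟩
    gcongr
    exact le_max_right _ _

end IsLittlewoodPaleyPair

/-- A Schwartz function that equals `1` on the ball containing the unit-scale spectrum. -/
theorem exists_fattened_symbol : ∃ M : 𝓢(ℝ, ℂ), ∀ ξ : ℝ, |ξ| ≤ 8 / 3 → M ξ = 1 := by
  let b : ContDiffBump (0 : ℝ) := ⟨8 / 3, 3, by norm_num, by norm_num⟩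
  obtain ⟨M, hM⟩ := exists_schwartzMap_eq_ofReal_comp b.contDiff 3 fun ξ hξ =>
    b.zero_of_le_dist (by simpa [b] using hξ.le)
  refine ⟨M, fun ξ hξ => ?_⟩
  rw [hM, b.one_of_mem_closedBall (by simpa [b] using hξ), Complex.ofReal_one]

/-- A Schwartz function that equals `ξ⁻¹` on an annulus. -/
theorem exists_annular_inverse_symbol : ∃ M : 𝓢(ℝ, ℂ), ∀ ξ : ℝ, 5 / 12 ≤ |ξ| → |ξ| ≤ 16 / 3 →
    M ξ * ξ = 1 := by
  let b : ContDiffBump (0 : ℝ) := ⟨16 / 3, 6, by norm_num, by norm_num⟩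
  -- Adding the bump `c` keeps the denominator of `ξ / (ξ ^ 2 + c ξ)` positive at the origin; `c`
  -- vanishes for `|ξ| ≥ 5 / 12`, where the quotient is `ξ⁻¹`.
  let c : ContDiffBump (0 : ℝ) := ⟨1 / 8, 5 / 12, by norm_num, by norm_num⟩
  have hpos : ∀ ξ : ℝ, 0 < ξ ^ 2 + c ξ := fun ξ => by
    rcases eq_or_ne ξ 0 with rfl | h
    · rw [c.one_of_mem_closedBall (by simp [c])]
      norm_num
    · have : 0 ≤ c ξ := c.nonneg
      positivity
  obtain ⟨M, hM⟩ := exists_schwartzMap_eq_ofReal_comp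
    (m := fun ξ => b ξ * (ξ / (ξ ^ 2 + c ξ)))
    (b.contDiff.mul (contDiff_id.div ((contDiff_id.pow 2).add c.contDiff) fun ξ => (hpos ξ).ne'))
    6 fun ξ hξ => by rw [b.zero_of_le_dist (by simpa [b] using hξ.le), zero_mul]
  refine ⟨M, fun ξ h1 h2 => ?_⟩
  have hξ : ξ ≠ 0 := by
    rintro rfl
    norm_num at h1
  rw [hM, b.one_of_mem_closedBall (by simpa [b] using h2),
    c.zero_of_le_dist (by simpa [c] using h1), ← Complex.ofReal_mul, ← Complex.ofReal_one]
  congr 1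
  field_simp
  ring

end Symbols

/-! ### Tempered distributions represented by `L^p` functions -/

section Representation

variable {p : ℝ≥0∞} [Fact (1 ≤ p)]

theorem Lp_toTemperedDistribution_injective : Function.Injective
    (Lp.toTemperedDistribution : Lp ℂ p (volume : Measure ℝ) → 𝓢'(ℝ, ℂ)) :=
  LinearMap.ker_eq_bot.1 (Lp.ker_toTemperedDistributionCLM_eq_bot (F := ℂ)
    (μ := (volume : Measure ℝ)) (p := p))

theorem distLpNorm_toTemperedDistribution (f : Lp ℂ p (volume : Measure ℝ)) :
    distLpNorm p (Lp.toTemperedDistribution f) = ‖f‖ₑ := by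
  refine le_antisymm (iInf₂_le_of_le f rfl le_rfl) (le_iInf₂ fun g hg => ?_)
  rw [Lp_toTemperedDistribution_injective hg]

theorem exists_toTemperedDistribution_eq {u : 𝓢'(ℝ, ℂ)} (hu : distLpNorm p u ≠ ⊤) :
    ∃ f : Lp ℂ p (volume : Measure ℝ), Lp.toTemperedDistribution f = u := by
  by_contra! h
  exact hu (by simp [distLpNorm, h])

theorem distLpNorm_zero : distLpNorm p 0 = 0 := by
  have h : (0 : 𝓢'(ℝ, ℂ)) =
      Lp.toTemperedDistribution (0 : Lp ℂ p (volume : Measure ℝ)) :=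
    (map_zero (Lp.toTemperedDistributionCLM ℂ volume p)).symm
  rw [h, distLpNorm_toTemperedDistribution, enorm_zero]

theorem toTemperedDistribution_eq_toLp {F : ℝ → ℂ} (hF : F.HasTemperateGrowth) (hp : MemLp F p) :
    hF.toTemperedDistribution volume = Lp.toTemperedDistribution (hp.toLp F) := by
  ext g
  rw [Lp.toTemperedDistribution_apply]
  change ∫ x, g x • F x = _
  refine integral_congr_ae ?_
  filter_upwards [hp.coeFn_toLp] with x hx
  rw [hx]

/-- If the right side is finite, the series converges absolutely in `L^p`, and uniqueness of limits
of tempered distributions identifies its sum with `t`. -/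
theorem distLpNorm_le_tsum {ι : Type*} {T : ι → 𝓢'(ℝ, ℂ)} {t : 𝓢'(ℝ, ℂ)} (h : HasSum T t) :
    distLpNorm p t ≤ ∑' i, distLpNorm p (T i) := by
  by_cases htop : ∑' i, distLpNorm p (T i) = ⊤
  · simp [htop]
  choose f hf using fun i => exists_toTemperedDistribution_eq (ENNReal.ne_top_of_tsum_ne_top htop i)
  have hn : ∀ i, distLpNorm p (T i) = ‖f i‖ₑ := fun i => by
    rw [← hf, distLpNorm_toTemperedDistribution]
  simp_rw [hn] at htop ⊢
  have hs : Summable fun i => ‖f i‖ := by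
    have := ENNReal.summable_toReal htop
    simpa using this
  have hsum : HasSum T (Lp.toTemperedDistribution (∑' i, f i)) := by
    have := hs.of_norm.hasSum.mapL (Lp.toTemperedDistributionCLM ℂ volume p)
    simpa [hf] using this
  rw [h.unique hsum, distLpNorm_toTemperedDistribution]
  exact enorm_tsum_le_tsum_enorm

/-- Hölder's inequality for the pairing of `L^p` with Schwartz functions. -/
theorem exists_norm_toTemperedDistribution_apply_le (p : ℝ≥0∞) [hp : Fact (1 ≤ p)]
    [Fact (1 ≤ (1 - p⁻¹)⁻¹)] :
    ∃ C : ℝ, 0 ≤ C ∧ ∀ (f : Lp ℂ p (volume : Measure ℝ)) (g : 𝓢(ℝ, ℂ)),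
      ‖Lp.toTemperedDistribution f g‖ ≤
        C * ‖f‖ * ‖SchwartzMap.toLpCLM ℂ ℂ (1 - p⁻¹)⁻¹ volume g‖ := by
  have := ENNReal.HolderConjugate.inv_one_sub_inv' hp.out
  refine ⟨‖(ContinuousLinearMap.lsmul ℂ ℂ (E := ℂ)).flip.lpPairing (volume : Measure ℝ) p
    (1 - p⁻¹)⁻¹‖, ContinuousLinearMap.opNorm_nonneg _, fun f g => ?_⟩
  exact ((ContinuousLinearMap.lsmul ℂ ℂ (E := ℂ)).flip.lpPairing (volume : Measure ℝ) p
    (1 - p⁻¹)⁻¹).le_opNorm₂ f (SchwartzMap.toLpCLM ℂ ℂ (1 - p⁻¹)⁻¹ volume g)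

/-- A family of tempered distributions with summable bounds against one continuous map into a
normed space is unconditionally summable. -/
theorem exists_hasSum_of_norm_apply_le {ι X : Type*} [NormedAddCommGroup X] [NormedSpace ℂ X]
    (T : 𝓢(ℝ, ℂ) →L[ℂ] X) {c : ι → ℝ} (hc : Summable c) {P : ι → 𝓢'(ℝ, ℂ)}
    (hP : ∀ i g, ‖P i g‖ ≤ c i * ‖T g‖) : ∃ w : 𝓢'(ℝ, ℂ), HasSum P w := by
  have hs : ∀ g, Summable fun i => P i g := fun g =>
    Summable.of_norm_bounded (hc.mul_right _) fun i => hP i g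
  let W : 𝓢(ℝ, ℂ) →ₗ[ℂ] ℂ :=
    { toFun := fun g => ∑' i, P i g
      map_add' := fun g g' => by
        simp_rw [map_add]
        exact (hs g).tsum_add (hs g')
      map_smul' := fun a g => by
        simp_rw [map_smul]
        exact (hs g).tsum_const_smul a }
  have hW : ∀ g, ‖W g‖ ≤ (∑' i, c i) * ‖T g‖ := fun g => by
    rw [← tsum_mul_right]
    exact tsum_of_norm_bounded (hc.mul_right _).hasSum fun i => hP i g
  have hcont : Continuous W := by
    refine continuous_of_continuousAt_zero W ?_
    rw [ContinuousAt, map_zero]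
    refine squeeze_zero_norm hW ?_
    have : Continuous fun g => (∑' i, c i) * ‖T g‖ := by fun_prop
    simpa using this.tendsto 0
  refine ⟨ContinuousLinearMap.toPointwiseConvergenceCLM ℂ (RingHom.id ℂ) 𝓢(ℝ, ℂ) ℂ ⟨W, hcont⟩, ?_⟩
  rw [HasSum, PointwiseConvergenceCLM.tendsto_iff_forall_tendsto]
  intro g
  have := (hs g).hasSum
  rw [HasSum] at this
  convert! this using 2 with s
  exact map_sum (PointwiseConvergenceCLM.evalCLM (RingHom.id ℂ) ℂ g) P s

end Representation

/-! ### Products of dyadic blocks -/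

section Products

variable {χ φ : ℝ → ℝ}

/-- The spectrum of `P` lies in the sum of the supports of the `i`-th and `j`-th symbols. -/
def HasProductSpectrum (χ φ : ℝ → ℝ) (i j : ℤ) (P : 𝓢'(ℝ, ℂ)) : Prop :=
  ∀ m : ℝ → ℂ, m.HasTemperateGrowth →
    (∀ ξ η, dyadicSymbol χ φ i ξ ≠ 0 → dyadicSymbol χ φ j η ≠ 0 → m (ξ + η) = 0) →
    TemperedDistribution.fourierMultiplierCLM ℂ m P = 0

theorem hasTemperateGrowth_dilation (S : 𝓢(ℝ, ℂ)) (c : ℝ) :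
    (fun ξ : ℝ => S (c * ξ)).HasTemperateGrowth :=
  S.hasTemperateGrowth.comp (ContinuousLinearMap.hasTemperateGrowth (ContinuousLinearMap.mul ℝ ℝ c))

/-- A dyadic block in `L^p` is a smooth function, which obeys Bernstein's inequality. -/
theorem IsLittlewoodPaleyPair.exists_smooth_dyadicBlock (h : IsLittlewoodPaleyPair χ φ) :
    ∃ C : ℝ≥0, ∀ (j : ℤ) (p : ℝ≥0∞) [Fact (1 ≤ p)] (u : 𝓢'(ℝ, ℂ))
      (f : Lp ℂ p (volume : Measure ℝ)), Lp.toTemperedDistribution f = dyadicBlock χ φ j u →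
      ∃ (F : ℝ → ℂ) (hF : F.HasTemperateGrowth),
        dyadicBlock χ φ j u = hF.toTemperedDistribution volume ∧
        ∀ q, p ≤ q → MemLp F q ∧ eLpNorm F q ≤
          C * ENNReal.ofReal (2 ^ j) ^ (p⁻¹.toReal - q⁻¹.toReal) * ‖f‖ₑ := by
  -- The dilated fattened symbol is `1` on the spectrum of the block, so the block is reproduced by
  -- a multiplier to which Bernstein applies.
  obtain ⟨M, hM⟩ := exists_fattened_symbol
  obtain ⟨C, hC⟩ := exists_bernstein M
  refine ⟨C, fun j p hp u f hf => ?_⟩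
  obtain ⟨F, hF, h1, h2⟩ := hC (2 ^ j) (by positivity) p f
  refine ⟨F, hF, ?_, h2⟩
  rw [← h1, hf, dyadicBlock, TemperedDistribution.fourierMultiplierCLM_fourierMultiplierCLM_apply
    (h.hasTemperateGrowth_dyadicSymbol j) (hasTemperateGrowth_dilation M _)]
  congr 2
  ext ξ
  by_cases hξ : dyadicSymbol χ φ j ξ = 0
  · simp [hξ]
  · have h3 := (h.dyadicSymbol_ne_zero hξ).2.1
    have h4 : (0 : ℝ) < 2 ^ j := by positivity
    rw [Pi.mul_apply, hM, mul_one]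
    rwa [abs_mul, abs_of_pos (inv_pos.2 h4), ← div_eq_inv_mul, div_le_iff₀ h4]

/-- The product of two dyadic blocks in `L^q` is given by a function in `L^{q/2}`. -/
theorem IsLittlewoodPaleyPair.exists_product (h : IsLittlewoodPaleyPair χ φ) (q m : ℝ≥0∞)
    [Fact (1 ≤ q)] [Fact (1 ≤ m)] [ENNReal.HolderTriple q q m] :
    ∃ C : ℝ≥0, ∀ (i j : ℤ) (u v : 𝓢'(ℝ, ℂ)) (f g : Lp ℂ q (volume : Measure ℝ)),
      Lp.toTemperedDistribution f = dyadicBlock χ φ i u →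
      Lp.toTemperedDistribution g = dyadicBlock χ φ j v →
      ∃ P : Lp ℂ m (volume : Measure ℝ),
        IsSmoothProduct (dyadicBlock χ φ i u) (dyadicBlock χ φ j v) (Lp.toTemperedDistribution P) ∧
        ‖P‖ₑ ≤ C * (‖f‖ₑ * ‖g‖ₑ) ∧ HasProductSpectrum χ φ i j (Lp.toTemperedDistribution P) := by
  obtain ⟨C, hC⟩ := h.exists_smooth_dyadicBlock
  refine ⟨C, fun i j u v f g hf hg => ?_⟩
  obtain ⟨F, hF, hF1, hF2⟩ := hC i q u f hf
  obtain ⟨hFm, hFn⟩ := hF2 q le_rfl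
  have hP : Lp.toTemperedDistribution (hFm.toLp F • g : Lp ℂ m (volume : Measure ℝ)) =
      TemperedDistribution.smulLeftCLM ℂ F (dyadicBlock χ φ j v) := by
    rw [← hg, Lp.toTemperedDistribution_smul_eq hF hFm g]
  refine ⟨hFm.toLp F • g, ⟨F, hF, hF1, hP⟩, ?_, fun m₁ hm₁ hz => ?_⟩
  · have h1 : ‖(hFm.toLp F • g : Lp ℂ m (volume : Measure ℝ))‖ₑ ≤ ‖hFm.toLp F‖ₑ * ‖g‖ₑ := by
      simp only [← ofReal_norm]
      rw [← ENNReal.ofReal_mul (norm_nonneg _)]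
      exact ENNReal.ofReal_le_ofReal (Lp.norm_smul_le _ _)
    refine h1.trans ?_
    rw [← mul_assoc]
    gcongr
    rw [Lp.enorm_toLp]
    simpa using hFn
  · rw [hP]
    exact fourierMultiplierCLM_smulLeftCLM_eq_zero hm₁ (h.hasTemperateGrowth_dyadicSymbol i)
      (h.hasTemperateGrowth_dyadicSymbol j) hF v u hF1 hz

/-- The constants are `16/3 = 8/3 + 8/3` and `5/12 = 3/4 - (8/3)/8`: a gap of at least three indices
makes the lower frequency scale at most an eighth of the higher one. -/
theorem IsLittlewoodPaleyPair.product_spectrum_bounds (h : IsLittlewoodPaleyPair χ φ) {i j : ℤ}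
    {ξ η : ℝ} (hξ : dyadicSymbol χ φ i ξ ≠ 0) (hη : dyadicSymbol χ φ j η ≠ 0) :
    |ξ + η| ≤ 16 / 3 * (2 : ℝ) ^ max i j ∧ (2 < |i - j| → 5 / 12 * (2 : ℝ) ^ max i j ≤ |ξ + η|) := by
  wlog hij : i ≤ j generalizing i j ξ η
  · rw [add_comm, max_comm, abs_sub_comm]
    exact this hη hξ (le_of_not_ge hij)
  obtain ⟨hi, hξ1, hξ2⟩ := h.dyadicSymbol_ne_zero hξ
  obtain ⟨hj, hη1, hη2⟩ := h.dyadicSymbol_ne_zero hη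
  rw [max_eq_right hij]
  have hmono : (2 : ℝ) ^ i ≤ 2 ^ j := zpow_le_zpow_right₀ one_le_two hij
  refine ⟨(abs_add_le ξ η).trans (by linarith), fun hd => ?_⟩
  rw [abs_of_nonpos (by omega)] at hd
  have h8 : (2 : ℝ) ^ i * 8 ≤ 2 ^ j := by
    have : (2 : ℝ) ^ i * 8 = 2 ^ (i + 3) := by
      rw [zpow_add₀ two_ne_zero]
      norm_num
    rw [this]
    exact zpow_le_zpow_right₀ one_le_two (by omega)
  have h9 := hη2 (by omega)
  have h10 : |η| ≤ |ξ + η| + |ξ| := by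
    calc |η| = |(ξ + η) - ξ| := by congr 1; ring
      _ ≤ _ := abs_sub _ _
  linarith

/-- A dyadic block of a product vanishes away from the sum of the spectra. -/
theorem IsLittlewoodPaleyPair.dyadicBlock_product_eq_zero (h : IsLittlewoodPaleyPair χ φ)
    {i j k : ℤ} {P : 𝓢'(ℝ, ℂ)} (hP : HasProductSpectrum χ φ i j P)
    (hk : ¬ (-1 ≤ i ∧ -1 ≤ j ∧ k ≤ max i j + 2 ∧ (|i - j| ≤ 2 ∨ max i j ≤ k + 2))) :
    dyadicBlock χ φ k P = 0 := by
  refine hP _ (h.hasTemperateGrowth_dyadicSymbol k) fun ξ η hξ hη => ?_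
  by_contra h0
  obtain ⟨h1, h2⟩ := h.product_spectrum_bounds hξ hη
  obtain ⟨h3, h4, h5⟩ := h.dyadicSymbol_ne_zero h0
  have hi := (h.dyadicSymbol_ne_zero hξ).1
  have hj := (h.dyadicSymbol_ne_zero hη).1
  refine hk ⟨hi, hj, ?_, ?_⟩
  · by_contra! hlt
    have h6 := h5 (by omega)
    -- Three octaves suffice, as `8 * (3/4) > 16/3`.
    have h7 : (2 : ℝ) ^ (max i j) * 8 ≤ 2 ^ k := by
      have : (2 : ℝ) ^ (max i j) * 8 = 2 ^ (max i j + 3) := by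
        rw [zpow_add₀ two_ne_zero]
        norm_num
      rw [this]
      exact zpow_le_zpow_right₀ one_le_two (by omega)
    have : (0 : ℝ) < 2 ^ (max i j) := by positivity
    linarith
  · by_contra! hlt
    have h6 := h2 hlt.1
    -- Here `8 * (5/12) > 8/3`.
    have h7 : (2 : ℝ) ^ k * 8 ≤ 2 ^ (max i j) := by
      have : (2 : ℝ) ^ k * 8 = 2 ^ (k + 3) := by
        rw [zpow_add₀ two_ne_zero]
        norm_num
      rw [this]
      exact zpow_le_zpow_right₀ one_le_two (by omega)
    have : (0 : ℝ) < 2 ^ k := by positivity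
    linarith

/-- The decay factor of the pairing of the product of the `i`-th and `j`-th blocks with a fixed
Schwartz function. -/
noncomputable def productDecay (i j : ℤ) : ℝ :=
  if |i - j| ≤ 2 then 1 else ((2 : ℝ) ^ max i j)⁻¹

/-- One of the two symbols vanishes identically, so even the multiplier `1` must annihilate `P`. -/
theorem IsLittlewoodPaleyPair.eq_zero_of_hasProductSpectrum (h : IsLittlewoodPaleyPair χ φ)
    {i j : ℤ} {P : 𝓢'(ℝ, ℂ)} (hP : HasProductSpectrum χ φ i j P) (hij : ¬ (-1 ≤ i ∧ -1 ≤ j)) :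
    P = 0 := by
  have := hP (fun _ => 1) (.const 1) fun ξ η hξ hη =>
    absurd ⟨(h.dyadicSymbol_ne_zero hξ).1, (h.dyadicSymbol_ne_zero hη).1⟩ hij
  simpa using this

open scoped FourierTransform in
/-- Products of dyadic blocks with separated frequencies oscillate, hence decay against Schwartz
functions. -/
theorem IsLittlewoodPaleyPair.exists_norm_product_apply_le (h : IsLittlewoodPaleyPair χ φ)
    (m : ℝ≥0∞) [hm : Fact (1 ≤ m)] [Fact (1 ≤ (1 - m⁻¹)⁻¹)] :
    ∃ (C : ℝ≥0) (T : 𝓢(ℝ, ℂ) →L[ℂ] Lp ℂ (1 - m⁻¹)⁻¹ (volume : Measure ℝ) ×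
      Lp ℂ (1 - m⁻¹)⁻¹ (volume : Measure ℝ)),
      ∀ (i j : ℤ) (P : Lp ℂ m (volume : Measure ℝ)),
        HasProductSpectrum χ φ i j (Lp.toTemperedDistribution P) → ∀ g : 𝓢(ℝ, ℂ),
        ‖Lp.toTemperedDistribution P g‖ ≤ C * productDecay i j * ‖P‖ * ‖T g‖ := by
  obtain ⟨C, hC0, hC⟩ := exists_norm_toTemperedDistribution_apply_le m
  lift C to ℝ≥0 using hC0
  obtain ⟨M, hM⟩ := exists_annular_inverse_symbol
  obtain ⟨B, hB⟩ := exists_bernstein M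
  set L := SchwartzMap.toLpCLM ℂ ℂ (1 - m⁻¹)⁻¹ (volume : Measure ℝ)
  have hid : (fun ξ : ℝ => (ξ : ℂ)).HasTemperateGrowth :=
    Function.Complex.hasTemperateGrowth_ofReal
  -- `D` is differentiation up to a constant factor. The map `T` records `g` and `D g` together, so
  -- that one norm controls both cases.
  let D : 𝓢(ℝ, ℂ) →L[ℂ] 𝓢(ℝ, ℂ) := FourierTransform.fourierCLM ℂ 𝓢(ℝ, ℂ) ∘L
    SchwartzMap.smulLeftCLM ℂ (fun ξ : ℝ => (ξ : ℂ)) ∘L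
      FourierTransform.fourierInvCLM ℂ 𝓢(ℝ, ℂ)
  let T := L.prod (L ∘L D)
  have hT1 : ∀ g, ‖L g‖ ≤ ‖T g‖ := fun g => norm_fst_le (T g)
  have hT2 : ∀ g, ‖L (D g)‖ ≤ ‖T g‖ := fun g => norm_snd_le (T g)
  refine ⟨C * max 1 B, T, fun i j P hP g => ?_⟩
  rw [NNReal.coe_mul, NNReal.coe_max, NNReal.coe_one]
  unfold productDecay
  split_ifs with hij
  · calc _ ≤ C * ‖P‖ * ‖L g‖ := hC P g
      _ ≤ C * max 1 (B : ℝ) * 1 * ‖P‖ * ‖T g‖ := by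
        rw [mul_one]
        gcongr
        · exact le_mul_of_one_le_right C.coe_nonneg (le_max_left _ _)
        · exact hT1 g
  set J := max i j
  have hJ : (0 : ℝ) < 2 ^ J := by positivity
  obtain ⟨H, hH, hH1, hH2⟩ := hB (2 ^ J) hJ m P
  obtain ⟨hHm, hHn⟩ := hH2 m le_rfl
  set s : ℝ → ℂ := fun ξ => M ((2 ^ J)⁻¹ * ξ) with hs
  have hsg : s.HasTemperateGrowth := hasTemperateGrowth_dilation M _
  -- `r ξ = M(2^{-J} ξ) (2^{-J} ξ)` equals `1` on the spectrum of `P`, so `P` is reproduced by `r`.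
  -- The factor `ξ` passes to the test function as `D`, and `2^{-J}` is the gain.
  set r : ℝ → ℂ := (((2 : ℝ) ^ J)⁻¹ : ℂ) • (s * fun ξ : ℝ => (ξ : ℂ)) with hr
  have hrg : r.HasTemperateGrowth := by
    have : r = fun ξ => (((2 : ℝ) ^ J)⁻¹ : ℂ) * (s ξ * (ξ : ℂ)) := rfl
    rw [this]
    fun_prop
  have hz := hP (fun ξ => 1 - r ξ) (by fun_prop) fun ξ η hξ hη => by
    obtain ⟨h1, h2⟩ := h.product_spectrum_bounds hξ hη
    have h3 := h2 (not_le.1 hij)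
    have h4 := hM ((2 ^ J)⁻¹ * (ξ + η))
      (by rwa [abs_mul, abs_of_pos (inv_pos.2 hJ), ← div_eq_inv_mul, le_div_iff₀ hJ])
      (by rwa [abs_mul, abs_of_pos (inv_pos.2 hJ), ← div_eq_inv_mul, div_le_iff₀ hJ])
    rw [sub_eq_zero, ← h4]
    simp only [hr, hs, Pi.smul_apply, Pi.mul_apply, smul_eq_mul]
    push_cast
    ring
  have hPr : Lp.toTemperedDistribution P =
      TemperedDistribution.fourierMultiplierCLM ℂ r (Lp.toTemperedDistribution P) := by
    have h5 := TemperedDistribution.fourierMultiplierCLM_const (F := ℂ) (E := ℝ) 1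
    ext g
    have h6 := congrArg (fun w : 𝓢'(ℝ, ℂ) => w g) hz
    have h7 : SchwartzMap.smulLeftCLM ℂ (fun ξ => 1 - r ξ) (𝓕⁻ g) =
        𝓕⁻ g - SchwartzMap.smulLeftCLM ℂ r (𝓕⁻ g) := by
      ext ξ
      rw [SchwartzMap.smulLeftCLM_apply_apply (by fun_prop), sub_apply,
        SchwartzMap.smulLeftCLM_apply_apply hrg]
      simp [sub_mul]
    simp only [TemperedDistribution.fourierMultiplierCLM_apply_apply, h7] at h6 ⊢
    rw [← FourierTransform.fourierCLM_apply (R := ℂ), map_sub, map_sub] at h6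
    simpa [sub_eq_zero] using h6
  have h8 : ‖hHm.toLp H‖ ≤ B * ‖P‖ := by
    rw [← ENNReal.ofReal_le_ofReal_iff (by positivity), ENNReal.ofReal_mul (by positivity),
      ofReal_norm, ofReal_norm, Lp.enorm_toLp]
    simpa using hHn
  have h9 : Lp.toTemperedDistribution P g =
      (((2 : ℝ) ^ J)⁻¹ : ℂ) * Lp.toTemperedDistribution (hHm.toLp H) (D g) := by
    rw [hPr, hr, TemperedDistribution.fourierMultiplierCLM_smul (hsg.mul hid),
      ← toTemperedDistribution_eq_toLp hH hHm, ← hH1]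
    change _ * TemperedDistribution.fourierMultiplierCLM ℂ (s * fun ξ : ℝ => (ξ : ℂ)) _ g = _
    rw [← TemperedDistribution.fourierMultiplierCLM_fourierMultiplierCLM_apply hsg hid]
    rfl
  rw [h9, norm_mul]
  have h10 : ‖(((2 : ℝ) ^ J)⁻¹ : ℂ)‖ = (2 ^ J)⁻¹ := by
    simp
  rw [h10]
  calc _ ≤ (2 ^ J)⁻¹ * (C * (B * ‖P‖) * ‖T g‖) := by
        gcongr
        refine (hC _ _).trans ?_
        gcongr
        exact hT2 g
    _ = C * B * (2 ^ J)⁻¹ * ‖P‖ * ‖T g‖ := by ring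
    _ ≤ _ := by
        gcongr
        exact le_max_right _ _

end Products

/-! ### Sequence space estimates -/

section Sequences

/-- Every term is at most the `ℓ^r` norm, so the interpolation lemma applies with `t = 1`. -/
theorem eLpNorm_count_antitone {a : ℤ → ℝ≥0∞} {r r' : ℝ≥0∞} (hr : r ≠ 0) (h : r ≤ r') :
    eLpNorm a r' Measure.count ≤ eLpNorm a r Measure.count := by
  by_cases htop : eLpNorm a r Measure.count = ⊤
  · simp [htop]
  simpa using eLpNorm_le_of_bound_of_eLpNorm_le (t := 1) hr h htop ENNReal.one_ne_top
    (fun i => by simpa using enorm_le_eLpNorm_count a i hr) le_rfl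

theorem eLpNorm_count_one (a : ℤ → ℝ≥0∞) : eLpNorm a 1 Measure.count = ∑' i, a i := by
  simp [eLpNorm_one_eq_lintegral_enorm, lintegral_count]

theorem eLpNorm_count_two (a : ℤ → ℝ≥0∞) :
    eLpNorm a 2 Measure.count = (∑' i, a i ^ (2 : ℝ)) ^ (1 / 2 : ℝ) := by
  simp [eLpNorm_eq_lintegral_rpow_enorm_toReal, lintegral_count]

theorem tsum_mul_le_eLpNorm_two (a b : ℤ → ℝ≥0∞) :
    ∑' i, a i * b i ≤ eLpNorm a 2 Measure.count * eLpNorm b 2 Measure.count := by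
  have h := ENNReal.lintegral_mul_le_Lp_mul_Lq (Measure.count : Measure ℤ)
    Real.HolderConjugate.two_two (f := a) (g := b) (measurable_of_countable _).aemeasurable
    (measurable_of_countable _).aemeasurable
  simpa only [lintegral_count, Pi.mul_apply, ← eLpNorm_count_two] using h

theorem eLpNorm_two_comp_add (b : ℤ → ℝ≥0∞) (d : ℤ) :
    eLpNorm (fun i => b (i + d)) 2 Measure.count = eLpNorm b 2 Measure.count := by
  rw [eLpNorm_count_two, eLpNorm_count_two, ← (Equiv.addRight d).tsum_eq fun i => b i ^ (2 : ℝ)]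
  rfl

/-- Summation over a band around the diagonal. -/
theorem tsum_near_diagonal_le (a b : ℤ → ℝ≥0∞) :
    ∑' i, ∑' j, (if |i - j| ≤ 2 then a i * b j else 0) ≤
      5 * (eLpNorm a 2 Measure.count * eLpNorm b 2 Measure.count) := by
  have h1 : ∀ i j, (if |i - j| ≤ 2 then a i * b j else 0) ≤
      ∑ d ∈ Finset.Icc (-2 : ℤ) 2, if j = i + d then a i * b j else 0 := fun i j => by
    split_ifs with hij
    · have hmem : j - i ∈ Finset.Icc (-2 : ℤ) 2 := by
        rw [abs_le] at hij
        exact Finset.mem_Icc.2 ⟨by omega, by omega⟩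
      refine le_trans ?_ (Finset.single_le_sum (fun _ _ => zero_le) hmem)
      rw [if_pos (by ring)]
    · exact zero_le
  calc _ ≤ ∑' i, ∑' j, ∑ d ∈ Finset.Icc (-2 : ℤ) 2, (if j = i + d then a i * b j else 0) :=
        ENNReal.tsum_le_tsum fun i => ENNReal.tsum_le_tsum (h1 i)
    _ = ∑ d ∈ Finset.Icc (-2 : ℤ) 2, ∑' i, a i * b (i + d) := by
        rw [← Summable.tsum_finsetSum fun _ _ => ENNReal.summable]
        refine tsum_congr fun i => ?_
        rw [Summable.tsum_finsetSum fun _ _ => ENNReal.summable]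
        simp
    _ ≤ ∑ d ∈ Finset.Icc (-2 : ℤ) 2, eLpNorm a 2 Measure.count * eLpNorm b 2 Measure.count := by
        refine Finset.sum_le_sum fun d _ => ?_
        rw [← eLpNorm_two_comp_add b d]
        exact tsum_mul_le_eLpNorm_two _ _
    _ = _ := by simp

theorem tsum_box_le (a b : ℤ → ℝ≥0∞) {A B : ℝ≥0∞} (ha : ∀ i, a i ≤ A) (hb : ∀ i, b i ≤ B) (k : ℤ) :
    ∑' i, ∑' j, (if i ∈ Finset.Icc (-1) (k + 2) ∧ j ∈ Finset.Icc (-1) (k + 2) then a i * b j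
      else 0) ≤ ((k + 4).toNat ^ 2 : ℕ) * (A * B) := by
  have h0 : ∀ i j, (if i ∈ Finset.Icc (-1) (k + 2) ∧ j ∈ Finset.Icc (-1) (k + 2) then a i * b j
      else 0) ≤ (if i ∈ Finset.Icc (-1) (k + 2) then A else 0) *
        (if j ∈ Finset.Icc (-1) (k + 2) then B else 0) := fun i j => by
    by_cases hi : i ∈ Finset.Icc (-1) (k + 2) <;> by_cases hj : j ∈ Finset.Icc (-1) (k + 2) <;>
      simp only [hi, hj, and_true, and_false, if_true, if_false, zero_le]
    exact mul_le_mul' (ha i) (hb j)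
  have h1 : ∀ D : ℝ≥0∞, ∑' i, (if i ∈ Finset.Icc (-1) (k + 2) then D else 0) =
      (k + 4).toNat * D := fun D => by
    rw [tsum_eq_sum (s := Finset.Icc (-1) (k + 2)) fun i hi => if_neg hi,
      Finset.sum_congr rfl fun i hi => if_pos hi]
    have : k + 2 + 1 - -1 = k + 4 := by ring
    simp [this]
  refine (ENNReal.tsum_le_tsum fun i => ENNReal.tsum_le_tsum (h0 i)).trans_eq ?_
  simp_rw [ENNReal.tsum_mul_left, ENNReal.tsum_mul_right, h1]
  push_cast
  ring

theorem ofReal_two_zpow (j : ℤ) : ENNReal.ofReal ((2 : ℝ) ^ j) = (2 : ℝ≥0∞) ^ (j : ℝ) := by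
  rw [← Real.rpow_intCast, ← ENNReal.ofReal_rpow_of_pos two_pos]
  simp

theorem two_rpow_add (x y : ℝ) : (2 : ℝ≥0∞) ^ (x + y) = 2 ^ x * 2 ^ y :=
  ENNReal.rpow_add _ _ two_ne_zero ENNReal.ofNat_ne_top

theorem two_rpow_mono {x y : ℝ} (h : x ≤ y) : (2 : ℝ≥0∞) ^ x ≤ 2 ^ y :=
  ENNReal.rpow_le_rpow_of_exponent_le one_le_two h

theorem two_rpow_ne_top (x : ℝ) : (2 : ℝ≥0∞) ^ x ≠ ⊤ :=
  ENNReal.rpow_ne_top_of_ne_zero two_ne_zero ENNReal.ofNat_ne_top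

theorem tsum_two_rpow_mul_ne_top {e : ℝ} (he : e < 0) :
    ∑' k : ℤ, (if -1 ≤ k then (2 : ℝ≥0∞) ^ (k * e) * (5 + ((k + 4).toNat ^ 2 : ℕ)) else 0) ≠ ⊤ := by
  have hinj : Function.Injective fun n : ℕ => (n : ℤ) - 1 := fun a b hab => by simpa using hab
  rw [← hinj.tsum_eq]
  swap
  · intro k hk
    have : -1 ≤ k := by
      by_contra h
      exact hk (if_neg h)
    exact ⟨(k + 1).toNat, by simp only; omega⟩
  set x : ℝ := (2 : ℝ) ^ e
  have hx0 : 0 < x := by positivity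
  have hx1 : x < 1 := Real.rpow_lt_one_of_one_lt_of_neg one_lt_two he
  have hterm : ∀ n : ℕ, (if -1 ≤ (n : ℤ) - 1 then (2 : ℝ≥0∞) ^ ((((n : ℤ) - 1 : ℤ) : ℝ) * e) *
      (5 + (((n : ℤ) - 1 + 4).toNat ^ 2 : ℕ)) else 0) =
      ENNReal.ofReal ((2 : ℝ) ^ (-e) * (x ^ n * (5 + (n + 3) ^ 2))) := fun n => by
    rw [if_pos (by omega)]
    have h1 : ((n : ℤ) - 1 + 4).toNat = n + 3 := by omega
    have h2 : (((n : ℤ) - 1 : ℤ) : ℝ) * e = -e + e * n := by push_cast; ring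
    have h3 : (2 : ℝ≥0∞) ^ (-e + e * n) = ENNReal.ofReal ((2 : ℝ) ^ (-e) * x ^ n) := by
      rw [← Real.rpow_natCast, ← Real.rpow_mul zero_le_two, ← Real.rpow_add two_pos,
        ← ENNReal.ofReal_rpow_of_pos two_pos]
      simp
    have h4 : (5 : ℝ≥0∞) + ((n + 3) ^ 2 : ℕ) = ENNReal.ofReal (5 + (n + 3) ^ 2) := by
      rw [ENNReal.ofReal_add (by norm_num) (by positivity), ENNReal.ofReal_pow (by positivity),
        ENNReal.ofReal_add (by positivity) (by norm_num)]
      simp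
    rw [h1, h2, h3, h4, ← ENNReal.ofReal_mul (by positivity), mul_assoc]
  simp_rw [hterm]
  have hs : Summable fun n : ℕ => (2 : ℝ) ^ (-e) * (x ^ n * (5 + (n + 3) ^ 2)) := by
    refine Summable.mul_left _ ?_
    have hn : ‖x‖ < 1 := by rwa [Real.norm_of_nonneg hx0.le]
    -- `5 + (n + 3) ^ 2 = 14 + 6 n + n ^ 2`.
    have := ((summable_pow_mul_geometric_of_norm_lt_one 0 hn).mul_left 14).add
      (((summable_pow_mul_geometric_of_norm_lt_one 1 hn).mul_left 6).add
        (summable_pow_mul_geometric_of_norm_lt_one 2 hn))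
    refine this.congr fun n => ?_
    ring
  exact hs.tsum_ofReal_ne_top

theorem tsum_two_rpow_ne_top {e : ℝ} (he : e < 0) :
    ∑' k : ℤ, (if -1 ≤ k then (2 : ℝ≥0∞) ^ (k * e) else 0) ≠ ⊤ := by
  refine ne_top_of_le_ne_top (tsum_two_rpow_mul_ne_top he) (ENNReal.tsum_le_tsum fun k => ?_)
  split_ifs
  · refine le_mul_of_one_le_right' ?_
    exact le_trans (by norm_num) le_self_add
  · exact le_rfl

end Sequences

/-! ### The product of two distributions with square summable blocks -/

section Product

variable {χ φ : ℝ → ℝ}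

/-- The interactions between the `i`-th and the `j`-th block. -/
theorem tsum_interactions_le (a b : ℤ → ℝ≥0∞) (k : ℤ) :
    ∑' i, ∑' j, (if -1 ≤ i ∧ -1 ≤ j ∧ k ≤ max i j + 2 ∧ (|i - j| ≤ 2 ∨ max i j ≤ k + 2)
      then a i * b j else 0) ≤ (5 + ((k + 4).toNat ^ 2 : ℕ)) *
        (eLpNorm a 2 Measure.count * eLpNorm b 2 Measure.count) := by
  have ha : ∀ i, a i ≤ eLpNorm a 2 Measure.count := fun i => by
    simpa using enorm_le_eLpNorm_count a i two_ne_zero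
  have hb : ∀ i, b i ≤ eLpNorm b 2 Measure.count := fun i => by
    simpa using enorm_le_eLpNorm_count b i two_ne_zero
  rw [add_mul]
  -- An interacting pair lies in the band `|i - j| ≤ 2` or has both indices in `[-1, k + 2]`.
  refine le_trans ?_ (add_le_add (tsum_near_diagonal_le a b) (tsum_box_le a b ha hb k))
  simp_rw [← ENNReal.tsum_add]
  refine ENNReal.tsum_le_tsum fun i => ENNReal.tsum_le_tsum fun j => ?_
  split_ifs with h1 h2 h3 h3
  · exact le_self_add
  · exact le_self_add
  · exact le_add_self
  · exfalso
    obtain ⟨hi, hj, -, h4⟩ := h1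
    have h5 := h4.resolve_left h2
    exact h3 ⟨Finset.mem_Icc.2 ⟨hi, (le_max_left i j).trans h5⟩,
      Finset.mem_Icc.2 ⟨hj, (le_max_right i j).trans h5⟩⟩
  all_goals exact zero_le

/-- The band is handled by Cauchy-Schwarz; off it, `2^{-max i j} ≤ 2^{-i/2} 2^{-j/2}` makes the
double sum factor. -/
theorem tsum_productDecay_ne_top {a b : ℤ → ℝ≥0∞} (ha : eLpNorm a 2 Measure.count ≠ ⊤)
    (hb : eLpNorm b 2 Measure.count ≠ ⊤) :
    ∑' i, ∑' j, (if -1 ≤ i ∧ -1 ≤ j then ENNReal.ofReal (productDecay i j) * (a i * b j) else 0)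
      ≠ ⊤ := by
  set A := eLpNorm a 2 Measure.count
  set B := eLpNorm b 2 Measure.count
  have ha' : ∀ i, a i ≤ A := fun i => by
    simpa using enorm_le_eLpNorm_count a i two_ne_zero
  have hb' : ∀ i, b i ≤ B := fun i => by
    simpa using enorm_le_eLpNorm_count b i two_ne_zero
  set w : ℤ → ℝ≥0∞ := fun k => if -1 ≤ k then (2 : ℝ≥0∞) ^ ((k : ℝ) * (-1 / 2)) else 0 with hw
  have hG : ∑' k, w k ≠ ⊤ := tsum_two_rpow_ne_top (by norm_num)
  have hle : ∑' i, ∑' j, (if -1 ≤ i ∧ -1 ≤ j then ENNReal.ofReal (productDecay i j) * (a i * b j)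
      else 0) ≤ 5 * (A * B) + ∑' i, ∑' j, (w i * A) * (w j * B) := by
    refine le_trans ?_ (add_le_add_left (tsum_near_diagonal_le a b) _)
    simp_rw [← ENNReal.tsum_add]
    refine ENNReal.tsum_le_tsum fun i => ENNReal.tsum_le_tsum fun j => ?_
    unfold productDecay
    split_ifs with h1 h2
    · simp
    · rw [zero_add, hw]
      simp only [if_pos h1.1, if_pos h1.2]
      rw [mul_mul_mul_comm]
      gcongr
      · rw [← zpow_neg, ofReal_two_zpow, ← two_rpow_add]
        refine two_rpow_mono ?_
        have h3 : (i : ℝ) ≤ (max i j : ℤ) := by exact_mod_cast le_max_left i j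
        have h4 : (j : ℝ) ≤ (max i j : ℤ) := by exact_mod_cast le_max_right i j
        push_cast at *
        linarith
      · exact ha' i
      · exact hb' j
    all_goals exact zero_le
  refine ne_top_of_le_ne_top ?_ hle
  simp_rw [ENNReal.tsum_mul_left, ENNReal.tsum_mul_right]
  finiteness

/-- Existence needs only that the decay factors times the `L^m` norms are summable. The bound on
`Δ_k w` then sums the `L^p` norms of `Δ_k` of the interacting products. -/
theorem IsLittlewoodPaleyPair.exists_isDistProduct (h : IsLittlewoodPaleyPair χ φ) (q m : ℝ≥0∞)
    [hq : Fact (1 ≤ q)] [hm : Fact (1 ≤ m)] [ENNReal.HolderTriple q q m] {θ : ℝ} (hθ : 0 ≤ θ) :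
    ∃ C : ℝ≥0, ∀ (u v : 𝓢'(ℝ, ℂ)) (f g : ℤ → Lp ℂ q (volume : Measure ℝ)),
      (∀ i, Lp.toTemperedDistribution (f i) = dyadicBlock χ φ i u) →
      (∀ i, Lp.toTemperedDistribution (g i) = dyadicBlock χ φ i v) →
      eLpNorm (fun i : ℤ => (2 : ℝ≥0∞) ^ (i * θ) * ‖f i‖ₑ) 2 Measure.count ≠ ⊤ →
      eLpNorm (fun i : ℤ => (2 : ℝ≥0∞) ^ (i * θ) * ‖g i‖ₑ) 2 Measure.count ≠ ⊤ →
      ∃ w : 𝓢'(ℝ, ℂ), IsDistProduct χ φ u v w ∧ ∀ (p : ℝ≥0∞) [Fact (1 ≤ p)], m ≤ p → ∀ k : ℤ,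
        distLpNorm p (dyadicBlock χ φ k w) ≤ if -1 ≤ k then
          C * 2 ^ (k * (m⁻¹.toReal - p⁻¹.toReal - θ)) * ((5 + ((k + 4).toNat ^ 2 : ℕ)) *
          (eLpNorm (fun i : ℤ => (2 : ℝ≥0∞) ^ (i * θ) * ‖f i‖ₑ) 2 Measure.count *
            eLpNorm (fun i : ℤ => (2 : ℝ≥0∞) ^ (i * θ) * ‖g i‖ₑ) 2 Measure.count)) else 0 := by
  obtain ⟨C₁, hC₁⟩ := h.exists_product q m
  have hconj : Fact (1 ≤ (1 - m⁻¹)⁻¹) := by simp [fact_iff]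
  obtain ⟨C₂, T, hC₂⟩ := h.exists_norm_product_apply_le m
  obtain ⟨C₃, hC₃⟩ := h.exists_bernstein_dyadicBlock
  -- The factor `2^{3θ}` pays for `i + j ≥ k - 3`.
  refine ⟨C₃ * C₁ * ((2 : ℝ≥0∞) ^ (3 * θ)).toNNReal, fun u v f g hf hg hA hB => ?_⟩
  set a : ℤ → ℝ≥0∞ := fun i : ℤ => (2 : ℝ≥0∞) ^ (i * θ) * ‖f i‖ₑ with ha
  set b : ℤ → ℝ≥0∞ := fun i : ℤ => (2 : ℝ≥0∞) ^ (i * θ) * ‖g i‖ₑ with hb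
  have hunit : ∀ i : ℤ, (2 : ℝ≥0∞) ^ (-(i * θ)) * (2 : ℝ≥0∞) ^ (i * θ) = 1 := fun i => by
    rw [← two_rpow_add, neg_add_cancel, ENNReal.rpow_zero]
  have hfa : ∀ i, ‖f i‖ₑ = 2 ^ (-(i * θ)) * a i := fun i => by
    rw [ha, ← mul_assoc, hunit, one_mul]
  have hgb : ∀ i, ‖g i‖ₑ = 2 ^ (-(i * θ)) * b i := fun i => by
    rw [hb, ← mul_assoc, hunit, one_mul]
  have hfg : ∀ i j : ℤ, ‖f i‖ₑ * ‖g j‖ₑ = 2 ^ (-((i + j) * θ)) * (a i * b j) := fun i j => by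
    rw [hfa, hgb, mul_mul_mul_comm, ← two_rpow_add]
    congr 2
    ring
  choose P hP₁ hP₂ hP₃ using fun i j => hC₁ i j u v (f i) (g j) (hf i) (hg j)
  have hsum : ∑' n : ℤ × ℤ, ENNReal.ofReal (productDecay n.1 n.2) * ‖P n.1 n.2‖ₑ ≠ ⊤ := by
    rw [ENNReal.tsum_prod (f := fun i j => ENNReal.ofReal (productDecay i j) * ‖P i j‖ₑ)]
    refine ne_top_of_le_ne_top (ENNReal.mul_ne_top
      (ENNReal.mul_ne_top (ENNReal.coe_ne_top (r := C₁)) (two_rpow_ne_top (2 * θ)))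
      (tsum_productDecay_ne_top hA hB)) ?_
    · simp_rw [← ENNReal.tsum_mul_left]
      refine ENNReal.tsum_le_tsum fun i => ENNReal.tsum_le_tsum fun j => ?_
      split_ifs with hij
      · calc _ ≤ ENNReal.ofReal (productDecay i j) * (C₁ * (2 ^ (2 * θ) * (a i * b j))) := by
              gcongr
              refine (hP₂ i j).trans ?_
              rw [hfg]
              refine mul_le_mul' le_rfl (mul_le_mul' (two_rpow_mono ?_) le_rfl)
              have h1 : (-1 : ℝ) ≤ i := by exact_mod_cast hij.1
              have h2 : (-1 : ℝ) ≤ j := by exact_mod_cast hij.2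
              nlinarith
          _ = _ := by ring
      · have h0 := h.eq_zero_of_hasProductSpectrum (hP₃ i j) hij
        have h1 : P i j = 0 := Lp_toTemperedDistribution_injective
          (h0.trans (map_zero (Lp.toTemperedDistributionCLM ℂ volume m)).symm)
        simp [h1]
  have hdec : ∀ i j, 0 ≤ productDecay i j := fun i j => by
    unfold productDecay
    split_ifs <;> positivity
  obtain ⟨w, hw⟩ := exists_hasSum_of_norm_apply_le T
    (c := fun n : ℤ × ℤ => C₂ * (productDecay n.1 n.2 * ‖P n.1 n.2‖))
    (P := fun n => Lp.toTemperedDistribution (P n.1 n.2))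
    (by
      refine Summable.mul_left _ ?_
      have := ENNReal.summable_toReal hsum
      simpa [ENNReal.toReal_mul, hdec] using this)
    (fun n s => by
      rw [← mul_assoc]
      exact hC₂ n.1 n.2 (P n.1 n.2) (hP₃ n.1 n.2) s)
  refine ⟨w, ⟨_, fun i j => hP₁ i j, hw⟩, fun p hp hmp k => ?_⟩
  split_ifs with hk
  swap
  · rw [dyadicBlock_of_le χ φ (by omega), distLpNorm_zero]
  have hwk : HasSum (fun n : ℤ × ℤ => dyadicBlock χ φ k (Lp.toTemperedDistribution (P n.1 n.2)))
      (dyadicBlock χ φ k w) :=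
    hw.mapL (TemperedDistribution.fourierMultiplierCLM ℂ (dyadicSymbol χ φ k))
  refine (distLpNorm_le_tsum hwk).trans ?_
  rw [ENNReal.tsum_prod (f := fun i j =>
    distLpNorm p (dyadicBlock χ φ k (Lp.toTemperedDistribution (P i j))))]
  refine le_trans ?_ (mul_le_mul_right (tsum_interactions_le a b k) _)
  simp_rw [← ENNReal.tsum_mul_left]
  refine ENNReal.tsum_le_tsum fun i => ENNReal.tsum_le_tsum fun j => ?_
  split_ifs with hij
  swap
  · rw [h.dyadicBlock_product_eq_zero (hP₃ i j) hij, distLpNorm_zero]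
    exact zero_le
  obtain ⟨F, hF, hF1, hF2⟩ := hC₃ k hk m (P i j)
  obtain ⟨hFm, hFn⟩ := hF2 p hmp
  rw [hF1, toTemperedDistribution_eq_toLp hF hFm, distLpNorm_toTemperedDistribution, Lp.enorm_toLp]
  refine hFn.trans ?_
  -- The larger index is at least `k - 2` and the smaller at least `-1`. With `θ ≥ 0` this turns
  -- `2^{-(i + j)θ}` into `2^{3θ - kθ}`.
  have hijk : (k : ℝ) - 3 ≤ i + j := by
    have : k - 3 ≤ i + j := by omega
    exact_mod_cast this
  calc _ ≤ C₃ * ENNReal.ofReal (2 ^ k) ^ (m⁻¹.toReal - p⁻¹.toReal) *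
        (C₁ * (2 ^ (3 * θ + -(k * θ)) * (a i * b j))) := by
        gcongr
        refine (hP₂ i j).trans ?_
        rw [hfg]
        refine mul_le_mul' le_rfl (mul_le_mul' (two_rpow_mono ?_) le_rfl)
        nlinarith
    _ = _ := by
        have h1 : (k : ℝ) * (m⁻¹.toReal - p⁻¹.toReal - θ) =
            k * (m⁻¹.toReal - p⁻¹.toReal) + -(k * θ) := by ring
        rw [ofReal_two_zpow, ← ENNReal.rpow_mul, h1, two_rpow_add, two_rpow_add]
        push_cast
        rw [ENNReal.coe_toNNReal (two_rpow_ne_top _)]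
        ring

end Product

/-! ### The product estimate in Besov spaces -/

section Besov

variable {χ φ : ℝ → ℝ}

theorem enorm_weighted_block_le_besovNorm (χ φ : ℝ → ℝ) (σ : ℝ) (p : ℝ≥0∞) [Fact (1 ≤ p)]
    {r : ℝ≥0∞} (hr : 1 ≤ r) (u : 𝓢'(ℝ, ℂ)) (j : ℤ) :
    (2 : ℝ≥0∞) ^ ((j : ℝ) * σ) * distLpNorm p (dyadicBlock χ φ j u) ≤ besovNorm χ φ σ p r u := by
  unfold besovNorm
  simpa using enorm_le_eLpNorm_count
    (fun j : ℤ => (2 : ℝ≥0∞) ^ ((j : ℝ) * σ) * distLpNorm p (dyadicBlock χ φ j u)) j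
    (zero_lt_one.trans_le hr).ne'

/-- The blocks of a distribution in `B^σ_{p,r}` are square summable in `L^q`, `q ≥ p`, with the
weight that Bernstein's inequality leaves. -/
theorem IsLittlewoodPaleyPair.exists_squareSummable_blocks (h : IsLittlewoodPaleyPair χ φ)
    (p q : ℝ≥0∞) [hp : Fact (1 ≤ p)] [hq : Fact (1 ≤ q)] (hpq : p ≤ q) {r : ℝ≥0∞} (hr : 1 ≤ r)
    {σ θ : ℝ} (hθ : θ < σ - p⁻¹.toReal + q⁻¹.toReal ∨
      (θ = σ - p⁻¹.toReal + q⁻¹.toReal ∧ r ≤ 2)) :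
    ∃ C : ℝ≥0, ∀ u : 𝓢'(ℝ, ℂ), MemBesov χ φ σ p r u →
      ∃ f : ℤ → Lp ℂ q (volume : Measure ℝ),
        (∀ i, Lp.toTemperedDistribution (f i) = dyadicBlock χ φ i u) ∧
        eLpNorm (fun i : ℤ => (2 : ℝ≥0∞) ^ (i * θ) * ‖f i‖ₑ) 2 Measure.count ≤
          C * besovNorm χ φ σ p r u := by
  obtain ⟨C, hC⟩ := h.exists_smooth_dyadicBlock
  set τ := σ - p⁻¹.toReal + q⁻¹.toReal with hτ
  have key : ∀ u : 𝓢'(ℝ, ℂ), MemBesov χ φ σ p r u →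
      ∃ f : ℤ → Lp ℂ q (volume : Measure ℝ),
        (∀ i, Lp.toTemperedDistribution (f i) = dyadicBlock χ φ i u) ∧
        ∀ i : ℤ, (2 : ℝ≥0∞) ^ (i * θ) * ‖f i‖ₑ ≤ C * (2 ^ (i * (θ - τ)) *
          (2 ^ (i * σ) * distLpNorm p (dyadicBlock χ φ i u))) := by
    intro u hu
    have hfin : ∀ i : ℤ, distLpNorm p (dyadicBlock χ φ i u) ≠ ⊤ := fun i htop => by
      have h1 := enorm_weighted_block_le_besovNorm χ φ σ p hr u i
      rw [htop, ENNReal.mul_top (by simp)] at h1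
      exact (h1.trans_lt hu).ne rfl
    have hex : ∀ i : ℤ, ∃ f : Lp ℂ q (volume : Measure ℝ),
        Lp.toTemperedDistribution f = dyadicBlock χ φ i u ∧ ‖f‖ₑ ≤
          C * ENNReal.ofReal (2 ^ i) ^ (p⁻¹.toReal - q⁻¹.toReal) *
            distLpNorm p (dyadicBlock χ φ i u) := fun i => by
      obtain ⟨g, hg⟩ := exists_toTemperedDistribution_eq (hfin i)
      obtain ⟨F, hF, hF1, hF2⟩ := hC i p u g hg
      obtain ⟨hFm, hFn⟩ := hF2 q hpq
      refine ⟨hFm.toLp F, by rw [hF1, toTemperedDistribution_eq_toLp hF hFm], ?_⟩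
      rwa [← hg, distLpNorm_toTemperedDistribution, Lp.enorm_toLp]
    choose f hf hfn using hex
    refine ⟨f, hf, fun i => (mul_le_mul' le_rfl (hfn i)).trans_eq ?_⟩
    have h1 : (i : ℝ) * θ + i * (p⁻¹.toReal - q⁻¹.toReal) = i * (θ - τ) + i * σ := by
      rw [hτ]
      ring
    calc _ = C * ((2 : ℝ≥0∞) ^ ((i : ℝ) * θ + i * (p⁻¹.toReal - q⁻¹.toReal)) *
          distLpNorm p (dyadicBlock χ φ i u)) := by
          rw [ofReal_two_zpow, ← ENNReal.rpow_mul, two_rpow_add]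
          ring
      _ = _ := by
          rw [h1, two_rpow_add]
          ring
  -- Below the critical weight a geometric factor is left over, so the supremum of the weighted
  -- blocks controls even the `ℓ^1` norm. At the critical weight nothing is left and `ℓ^r ⊆ ℓ^2` is
  -- needed.
  rcases hθ with hlt | ⟨rfl, hr2⟩
  · have hG := tsum_two_rpow_ne_top (sub_neg.2 hlt)
    refine ⟨C * (∑' k : ℤ, (if -1 ≤ k then (2 : ℝ≥0∞) ^ (k * (θ - τ)) else 0)).toNNReal,
      fun u hu => ?_⟩
    obtain ⟨f, hf, hfn⟩ := key u hu
    refine ⟨f, hf, (eLpNorm_count_antitone one_ne_zero one_le_two).trans ?_⟩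
    rw [eLpNorm_count_one]
    push_cast
    rw [ENNReal.coe_toNNReal hG, mul_assoc, ← ENNReal.tsum_mul_right, ← ENNReal.tsum_mul_left]
    refine ENNReal.tsum_le_tsum fun i => (hfn i).trans ?_
    split_ifs with hi
    · gcongr
      exact enorm_weighted_block_le_besovNorm χ φ σ p hr u i
    · rw [dyadicBlock_of_le χ φ (by omega), distLpNorm_zero]
      simp
  · refine ⟨C, fun u hu => ?_⟩
    obtain ⟨f, hf, hfn⟩ := key u hu
    refine ⟨f, hf, ?_⟩
    have h1 := eLpNorm_le_nnreal_smul_eLpNorm_of_ae_le_mul' (μ := (Measure.count : Measure ℤ))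
      (f := fun i : ℤ => (2 : ℝ≥0∞) ^ (i * τ) * ‖f i‖ₑ)
      (g := fun i : ℤ => (2 : ℝ≥0∞) ^ ((i : ℝ) * σ) * distLpNorm p (dyadicBlock χ φ i u)) (c := C)
      (.of_forall fun i => by simpa using hfn i) 2
    rw [ENNReal.smul_def, smul_eq_mul] at h1
    refine h1.trans (mul_le_mul' le_rfl ?_)
    exact eLpNorm_count_antitone (zero_lt_one.trans_le hr).ne' hr2

/-- Since the exponent in `hρ` is strictly negative, the weighted blocks of `w` are summable despite
the quadratic factor; their `ℓ^1` norm dominates the `ℓ^r` norm. -/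
theorem besov_product (h : IsLittlewoodPaleyPair χ φ) (p q m : ℝ≥0∞) [hp : Fact (1 ≤ p)]
    [Fact (1 ≤ q)] [Fact (1 ≤ m)] [ENNReal.HolderTriple q q m] (hpq : p ≤ q) (hmp : m ≤ p)
    {r : ℝ≥0∞} (hr : 1 ≤ r) {σ θ ρ : ℝ} (hθ₀ : 0 ≤ θ)
    (hθ : θ < σ - p⁻¹.toReal + q⁻¹.toReal ∨ (θ = σ - p⁻¹.toReal + q⁻¹.toReal ∧ r ≤ 2))
    (hρ : ρ + (m⁻¹.toReal - p⁻¹.toReal - θ) < 0) :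
    ∃ C : ℝ≥0, ∀ u v : 𝓢'(ℝ, ℂ), MemBesov χ φ σ p r u → MemBesov χ φ σ p r v →
      ∃ w : 𝓢'(ℝ, ℂ), IsDistProduct χ φ u v w ∧ besovNorm χ φ ρ p r w ≤
        C * besovNorm χ φ σ p r u * besovNorm χ φ σ p r v := by
  obtain ⟨C₁, hC₁⟩ := h.exists_squareSummable_blocks p q hpq hr hθ
  obtain ⟨C₂, hC₂⟩ := h.exists_isDistProduct q m hθ₀
  have hG := tsum_two_rpow_mul_ne_top hρ
  refine ⟨C₂ * C₁ * C₁ * (∑' k : ℤ, (if -1 ≤ k then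
    (2 : ℝ≥0∞) ^ (k * (ρ + (m⁻¹.toReal - p⁻¹.toReal - θ))) * (5 + ((k + 4).toNat ^ 2 : ℕ))
      else 0)).toNNReal, fun u v hu hv => ?_⟩
  obtain ⟨f, hf, hfn⟩ := hC₁ u hu
  obtain ⟨g, hg, hgn⟩ := hC₁ v hv
  obtain ⟨w, hw, hwn⟩ := hC₂ u v f g hf hg
    (ne_top_of_le_ne_top (ENNReal.mul_ne_top ENNReal.coe_ne_top hu.ne) hfn)
    (ne_top_of_le_ne_top (ENNReal.mul_ne_top ENNReal.coe_ne_top hv.ne) hgn)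
  refine ⟨w, hw, (eLpNorm_count_antitone one_ne_zero hr).trans ?_⟩
  rw [eLpNorm_count_one]
  simp only [ENNReal.coe_mul]
  rw [ENNReal.coe_toNNReal hG]
  calc ∑' k : ℤ, (2 : ℝ≥0∞) ^ ((k : ℝ) * ρ) * distLpNorm p (dyadicBlock χ φ k w)
      ≤ ∑' k : ℤ, (if -1 ≤ k then (2 : ℝ≥0∞) ^ (k * (ρ + (m⁻¹.toReal - p⁻¹.toReal - θ))) *
        (5 + ((k + 4).toNat ^ 2 : ℕ)) else 0) * (C₂ * ((C₁ * besovNorm χ φ σ p r u) *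
          (C₁ * besovNorm χ φ σ p r v))) := by
        refine ENNReal.tsum_le_tsum fun k => (mul_le_mul' le_rfl (hwn p hmp k)).trans ?_
        split_ifs with hk
        · rw [mul_add (k : ℝ), two_rpow_add]
          calc _ ≤ (2 : ℝ≥0∞) ^ ((k : ℝ) * ρ) * (C₂ * 2 ^ (k * (m⁻¹.toReal - p⁻¹.toReal - θ)) *
                ((5 + ((k + 4).toNat ^ 2 : ℕ)) * ((C₁ * besovNorm χ φ σ p r u) *
                (C₁ * besovNorm χ φ σ p r v)))) := by gcongr
            _ = _ := by ring
        · simp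
    _ = _ := by
        rw [ENNReal.tsum_mul_right]
        ring

end Besov

theorem lemma3p2 (χ φ : ℝ → ℝ) (hχφ : IsLittlewoodPaleyPair χ φ)
    (s : ℝ) (p r : ℝ≥0∞) [Fact (1 ≤ p)] (hr : 1 ≤ r)
    (hspr : max 2 ((p⁻¹).toReal + 3 / 2) < s ∨ (s = 2 ∧ 2 ≤ p ∧ r ≤ 2)) :
    ∃ C : ℝ≥0, ∀ u v : 𝓢'(ℝ, ℂ),
      MemBesov χ φ (s - 2) p r u → MemBesov χ φ (s - 2) p r v →
      ∃ w : 𝓢'(ℝ, ℂ), IsDistProduct χ φ u v w ∧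
        besovNorm χ φ (s - 3) p r w ≤
          C * besovNorm χ φ (s - 2) p r u * besovNorm χ φ (s - 2) p r v := by
  have hp1 : 1 ≤ p := Fact.out
  set q : ℝ≥0∞ := max p 2 with hq
  have hq2 : 2 ≤ q := le_max_right _ _
  have hpq : p ≤ q := le_max_left _ _
  have hqinv : q⁻¹ ≤ 2⁻¹ := ENNReal.inv_le_inv.2 hq2
  set m : ℝ≥0∞ := (q⁻¹ + q⁻¹)⁻¹ with hm
  have hminv : m⁻¹ = q⁻¹ + q⁻¹ := inv_inv _
  have : Fact (1 ≤ q) := ⟨one_le_two.trans hq2⟩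
  have : Fact (1 ≤ m) := ⟨by
    rw [hm, ENNReal.one_le_inv, ← ENNReal.inv_two_add_inv_two]
    gcongr⟩
  have : ENNReal.HolderTriple q q m := ⟨hminv.symm⟩
  have hmp : m ≤ p := by
    rw [← ENNReal.inv_le_inv, hminv]
    rcases le_total p 2 with h2 | h2
    · rw [hq, max_eq_right h2, ENNReal.inv_two_add_inv_two]
      exact ENNReal.inv_le_one.2 hp1
    · rw [hq, max_eq_left h2]
      exact le_self_add
  have hqtop : q⁻¹ ≠ ⊤ := ne_top_of_le_ne_top (by simp) hqinv
  have hmreal : m⁻¹.toReal = q⁻¹.toReal + q⁻¹.toReal := by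
    rw [hminv, ENNReal.toReal_add hqtop hqtop]
  have hqreal : q⁻¹.toReal ≤ 1 / 2 := by
    simpa using ENNReal.toReal_mono (by simp) hqinv
  rcases hspr with hs | ⟨rfl, hp2, hr2⟩
  · obtain ⟨hs1, hs2⟩ := max_lt_iff.1 hs
    set τ := s - 2 - p⁻¹.toReal + q⁻¹.toReal with hτ
    -- For `p ≤ 2` this is `s > 1/p + 3/2`; for `p ≥ 2` it is `s > 2`.
    have hτ0 : 0 < τ := by
      rcases le_total p 2 with h2 | h2
      · have : q⁻¹.toReal = 1 / 2 := by
          rw [hq, max_eq_right h2]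
          simp
        rw [hτ, this]
        linarith
      · rw [hτ, hq, max_eq_left h2]
        linarith
    have h1 : τ / 2 ≤ max (τ / 2) (τ - 1 / 4) := le_max_left _ _
    have h2 : τ - 1 / 4 ≤ max (τ / 2) (τ - 1 / 4) := le_max_right _ _
    -- This `θ` is positive, strictly below `τ`, and within `1/4` of it; the final exponent is then
    -- at most `1/q - 3/4 ≤ -1/4`.
    refine besov_product hχφ p q m hpq hmp hr (θ := max (τ / 2) (τ - 1 / 4)) (by linarith)
      (.inl (max_lt (by linarith) (by linarith))) ?_
    rw [hmreal]
    linarith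
  · have hqp : q = p := max_eq_left hp2
    -- At the endpoint `q = p` and `τ = 0`, and the final exponent is `1/p - 1 ≤ -1/2`.
    refine besov_product hχφ p q m hpq hmp hr (θ := 0) le_rfl (.inr ⟨?_, hr2⟩) ?_
    · rw [hqp]
      ring
    · rw [hmreal, hqp]
      rw [hqp] at hqreal
      linarith
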